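/- Let $M\subset\mathcal M$ be an inclusion of factors (von Neumann algebras with trivial center, with the same unit) on a complex Hilbert space; no separability is assumed. For a von Neumann algebra $P$ write $P'$ for its commutant and $\mathcal U(P)$ for its unitary group. Recall that an inclusion $P\subset \mathcal Q$ of factors is called: - *ergodic* if $P'\cap\mathcal Q=\mathbb C1$; - *MV-ergodic* if for every $x\in\mathcal Q$ the closure, in the weak operator topology, of the convex hull of $\{uxu^*\mid u\in\mathcal U(P)\}$ contains a scalar multiple of $1$; - *$R$-ergodic* if $P$ contains a copy $R$ of the hyperfinite $\mathrm{II}_1$ factor such that $R'\cap\mathcal Q=\mathbb C1$; - *MASA-ergodic* if $P$ contains an abelian $*$-subalgebra $A$ with $A'\cap\mathcal Q=A$. If $P$ is of type $\mathrm{II}_1$, then $P\subset\mathcal Q$ is *stably MV-ergodic* if $pPp\subset p\mathcal Qp$ is MV-ergodic for every projection $p\in P$. **Proposition.** If $M\subset\mathcal M$ is $R$-ergodic or MASA-ergodic, then $M\subset\mathcal M$ is MV-ergodic; if moreover $M$ is of type $\mathrm{II}_1$, then $M\subset\mathcal M$ is stably MV-ergodic. If $M\subset\mathcal M$ is MV-ergodic,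 then it is ergodic. -/

import Mathlib

namespace VonNeumannAlgebra

variable {H : Type*} [NormedAddCommGroup H] [InnerProductSpace ℂ H] [CompleteSpace H]

/-- A factor: a nonzero von Neumann algebra with trivial center. -/
def IsFactor (M : VonNeumannAlgebra H) : Prop :=
  Nontrivial H ∧ ∀ z ∈ M, z ∈ M.commutant → ∃ c : ℂ, z = c • (1 : H →L[ℂ] H)

/-- `τ` is a faithful normal tracial state on `M`. Normality is expressed as σ-weak continuity:
`τ x = ∑ₙ ⟪ξₙ, x ηₙ⟫` for some square-summable sequences of vectors `ξ`, `η`. -/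
structure IsNormalTracialState (M : VonNeumannAlgebra H)
    (τ : M.toStarSubalgebra →ₗ[ℂ] ℂ) : Prop where
  map_one : τ 1 = 1
  nonneg : ∀ x, 0 ≤ (τ (star x * x)).re ∧ (τ (star x * x)).im = 0
  faithful : ∀ x, τ (star x * x) = 0 → x = 0
  tracial : ∀ x y, τ (x * y) = τ (y * x)
  normal : ∃ ξ η : ℕ → H, (Summable fun n => ‖ξ n‖ ^ 2) ∧ (Summable fun n => ‖η n‖ ^ 2) ∧
    ∀ x : M.toStarSubalgebra, HasSum (fun n => inner ℂ (ξ n) ((x : H →L[ℂ] H) (η n))) (τ x)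

/-- A II₁ factor: an infinite-dimensional factor with a faithful normal tracial state. -/
def IsTypeII1Factor (M : VonNeumannAlgebra H) : Prop :=
  M.IsFactor ∧ ¬ FiniteDimensional ℂ M.toStarSubalgebra ∧
    ∃ τ : M.toStarSubalgebra →ₗ[ℂ] ℂ, M.IsNormalTracialState τ

/-- A hyperfinite (approximately finite-dimensional) II₁ factor: a II₁ factor generated, as a von
Neumann algebra, by an increasing sequence of finite-dimensional *-subalgebras. -/
def IsHyperfiniteII1Factor (R : VonNeumannAlgebra H) : Prop :=
  R.IsTypeII1Factor ∧ ∃ B : ℕ → StarSubalgebra ℂ (H →L[ℂ] H),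
    Monotone B ∧ (∀ n, FiniteDimensional ℂ (B n)) ∧
    Set.centralizer (Set.centralizer (⋃ n, (B n : Set (H →L[ℂ] H)))) = (R : Set (H →L[ℂ] H))

/-- The closed convex hull of a set of operators, in the weak operator topology.
(On bounded sets of operators this topology coincides with the σ-weak topology.) -/
def weakClosedConvexHull (S : Set (H →L[ℂ] H)) : Set (H →L[ℂ] H) :=
  {y | ContinuousLinearMapWOT.ofCLM y ∈
    closure ((ContinuousLinearMapWOT.ofCLM : (H →L[ℂ] H) → (H →WOT[ℂ] H)) '' convexHull ℝ S)}

/-- The conjugates `u x u*`, for `u` in the unitary group of a *-algebra `P` of operators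
whose unit is the projection `e`. -/
def unitaryOrbit (e : H →L[ℂ] H) (P : Set (H →L[ℂ] H)) (x : H →L[ℂ] H) : Set (H →L[ℂ] H) :=
  {y | ∃ u ∈ P, star u * u = e ∧ u * star u = e ∧ y = u * x * star u}

/-- Mean-value ergodicity of an inclusion `P ⊆ Q` of *-algebras of operators with common unit the
projection `e`: for every `x ∈ Q`, the weakly closed convex hull of the conjugates of `x` by the
unitaries of `P` contains a scalar multiple of the unit. -/
def MVErgodicWithUnit (e : H →L[ℂ] H) (P Q : Set (H →L[ℂ] H)) : Prop :=
  ∀ x ∈ Q, ∃ c : ℂ, c • e ∈ weakClosedConvexHull (unitaryOrbit e P x)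

/-- The corner `p M p`, an algebra of operators with unit `p`
(zero on the orthogonal complement of the range of `p`). -/
def corner (p : H →L[ℂ] H) (M : VonNeumannAlgebra H) : Set (H →L[ℂ] H) :=
  {y | ∃ x ∈ M, y = p * x * p}

/-- The inclusion `M ⊆ N` is ergodic (irreducible): `M' ∩ N = ℂ1`. -/
def IsErgodic (M N : VonNeumannAlgebra H) : Prop :=
  (M.commutant : Set (H →L[ℂ] H)) ∩ N = Set.range fun c : ℂ => c • (1 : H →L[ℂ] H)

/-- The inclusion `M ⊆ N` is MV-ergodic. -/
def IsMVErgodic (M N : VonNeumannAlgebra H) : Prop :=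
  MVErgodicWithUnit 1 (M : Set (H →L[ℂ] H)) (N : Set (H →L[ℂ] H))

/-- The inclusion `M ⊆ N` is stably MV-ergodic: `pMp ⊆ pNp` is MV-ergodic for every
projection `p ∈ M`. -/
def IsStablyMVErgodic (M N : VonNeumannAlgebra H) : Prop :=
  ∀ p ∈ M, IsStarProjection p → MVErgodicWithUnit p (corner p M) (corner p N)

/-- The inclusion `M ⊆ N` is MASA-ergodic: `M` contains an abelian *-subalgebra `A` that is
maximal abelian in `N`, i.e. `A' ∩ N = A`. -/
def IsMASAErgodic (M N : VonNeumannAlgebra H) : Prop :=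
  ∃ A : StarSubalgebra ℂ (H →L[ℂ] H), (∀ a ∈ A, ∀ b ∈ A, a * b = b * a) ∧
    (A : Set (H →L[ℂ] H)) ⊆ M ∧
    Set.centralizer (A : Set (H →L[ℂ] H)) ∩ N = (A : Set (H →L[ℂ] H))

/-- The inclusion `M ⊆ N` is `R`-ergodic: `M` contains a copy of the hyperfinite II₁ factor
that is ergodic in `N`. -/
def IsRErgodic (M N : VonNeumannAlgebra H) : Prop :=
  ∃ R : VonNeumannAlgebra H, R ≤ M ∧ R.IsHyperfiniteII1Factor ∧ R.IsErgodic N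

end VonNeumannAlgebra

/-!
Write `averages p x` for the weakly closed convex hull of the conjugates of `x` by the unitaries of
`M` commuting with a projection `p ∈ M`. These sets are weakly compact, and averages of averages of
`x` are averages of `x`. Mean-value ergodicity of `p M p ⊆ p N p` follows when `averages p x` meets
`ℂ p` for all `x ∈ p N p` (`IsMVErgodicAt`). If `x` commutes with `M`, then `x` is its only average;
hence mean-value ergodicity implies ergodicity.

*Averaging inside a factor* (`IsFactor.exists_smul_mem_averages`). For `x ∈ p M p` the averages meet
`ℂ p`. An extreme point of the unit ball of `f M e` is a partial isometry exhibiting one of the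
projections `e`, `f` as equivalent to a subprojection of the other. Applied to the supports of the
positive and negative parts of a self-adjoint element, this gives a symmetry `u` such that
`(a + u a u⋆) / 2` is closer to the scalars than `a` by a factor `3 / 4`. Since the distance to the
scalars attains its minimum on the weakly compact set of averages, the minimum is zero.

*From `N` to `M`.* It suffices to find a *-subalgebra `C ⊆ M` all of whose projections are
mean-value ergodic (`IsAveragingSubalgebra`).
* If `A` is maximal abelian in `N`, take `C = A`. By the Markov–Kakutani theorem some average of `x`
  commutes with `A`, hence lies in `A ⊆ M`, and can be averaged further inside `M`.
* If `R` is ergodic in `N` and generated by an increasing sequence of finite-dimensional algebras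
  `B n`, take for `C` the union of the `B n`. For a projection `p` in some `B n`, integration over
  compact unitary groups and a weak limit yield an average `y` of `x` commuting with all
  `p (B m) p`. Such a `y` is a multiple of `p` (`exists_eq_smul_of_commute_corner`): averaging `y`
  and `p` simultaneously over the unitaries of `B m` preserves the relation `p Y p = y (p P p)`, and
  in the limit `Y` and `P` commute with `R`, hence are scalars, where `P ≠ 0` as it has the trace
  of `p`.

*Stability.* Let `M` be of type `II₁`. The algebra `C` contains nonzero projections of arbitrarily
small trace: otherwise its unit would be a finite sum of atoms of `C`, these would be atoms of `N`
too, and `M` would be finite-dimensional. Mean-value ergodicity of `p` passes to equivalent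
projections, to orthogonal sums, and to projections `p` containing mean-value ergodic subprojections
`q` with `p - q` of arbitrarily small trace. By comparison every projection of `M` is, up to small
trace, an orthogonal sum of copies of a small projection of `C`.
-/

set_option linter.unusedSectionVars false

namespace VonNeumannAlgebra

open Filter Topology ContinuousLinearMapWOT

variable {H : Type*} [NormedAddCommGroup H] [InnerProductSpace ℂ H] [CompleteSpace H]

/-! ### Weak operator closed and weak operator compact sets -/

/-- A set of operators is WOT-closed if it is closed in the weak operator topology. -/
def IsWOTClosed (S : Set (H →L[ℂ] H)) : Prop :=
  IsClosed ((toCLM : (H →WOT[ℂ] H) → (H →L[ℂ] H)) ⁻¹' S)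

theorem IsWOTClosed.inter {S T : Set (H →L[ℂ] H)} (hS : IsWOTClosed S) (hT : IsWOTClosed T) :
    IsWOTClosed (S ∩ T) :=
  IsClosed.inter hS hT

theorem continuous_mul_left_wot (a : H →L[ℂ] H) :
    Continuous fun x : H →WOT[ℂ] H => ofCLM a * x := by
  refine continuous_iff.2 fun ξ η => ?_
  have h : ∀ x : H →WOT[ℂ] H,
      inner ℂ η ((ofCLM a * x) ξ) = inner ℂ (ContinuousLinearMap.adjoint a η) (x ξ) := fun x => by
    rw [ContinuousLinearMap.adjoint_inner_left]; rfl
  simp_rw [h]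
  fun_prop

theorem continuous_mul_right_wot (a : H →L[ℂ] H) :
    Continuous fun x : H →WOT[ℂ] H => x * ofCLM a := by
  refine continuous_iff.2 fun ξ η => ?_
  exact (continuous_iff.1 continuous_id) (a ξ) η

/-- The operator norm is weak operator lower semicontinuous. -/
theorem isWOTClosed_setOf_norm_le {f : (H →L[ℂ] H) → (H →L[ℂ] H)} (C : ℝ)
    (hf : Continuous fun x : H →WOT[ℂ] H => (ofCLM (f x.toCLM) : H →WOT[ℂ] H)) :
    IsWOTClosed {x : H →L[ℂ] H | ‖f x‖ ≤ C} := by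
  by_cases hC : 0 ≤ C
  · have h : (toCLM : (H →WOT[ℂ] H) → (H →L[ℂ] H)) ⁻¹' {x | ‖f x‖ ≤ C} =
        ⋂ (ξ : H) (η : H), {x : H →WOT[ℂ] H |
          ‖inner ℂ η ((ofCLM (f x.toCLM) : H →WOT[ℂ] H) ξ)‖ ≤ C * ‖ξ‖ * ‖η‖} := by
      ext x
      simp only [Set.mem_preimage, Set.mem_ofPred_eq, Set.mem_iInter, ofCLM_apply]
      constructor
      · intro hx ξ η
        calc ‖inner ℂ η (f x.toCLM ξ)‖ ≤ ‖η‖ * ‖f x.toCLM ξ‖ := norm_inner_le_norm _ _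
          _ ≤ ‖η‖ * (C * ‖ξ‖) := by gcongr; exact ContinuousLinearMap.le_of_opNorm_le _ hx _
          _ = _ := by ring
      · intro hx
        refine ContinuousLinearMap.opNorm_le_bound _ hC fun ξ => ?_
        have h1 := hx ξ (f x.toCLM ξ)
        rw [inner_self_eq_norm_sq_to_K, norm_pow, RCLike.norm_ofReal, abs_norm, pow_two] at h1
        rcases (norm_nonneg (f x.toCLM ξ)).eq_or_lt with h0 | h0
        · rw [← h0]; positivity
        · exact le_of_mul_le_mul_right h1 h0
    rw [IsWOTClosed, h]
    refine isClosed_iInter fun ξ => isClosed_iInter fun η => isClosed_le ?_ continuous_const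
    exact ((continuous_iff.1 hf) ξ η).norm
  · have : {x : H →L[ℂ] H | ‖f x‖ ≤ C} = ∅ := by
      ext x; simp only [Set.mem_ofPred_eq, Set.mem_empty_iff_false, iff_false, not_le]
      exact (not_le.1 hC).trans_le (norm_nonneg _)
    rw [this]; exact isClosed_empty

theorem isWOTClosed_closedBall (C : ℝ) : IsWOTClosed {x : H →L[ℂ] H | ‖x‖ ≤ C} :=
  isWOTClosed_setOf_norm_le C continuous_id

/-- Closed balls of operators are compact in the weak operator topology: the matrix coefficients
converge along an ultrafilter, and their limits form a bounded sesquilinear form. -/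
theorem isCompact_wot_closedBall (C : ℝ) :
    IsCompact ((toCLM : (H →WOT[ℂ] H) → (H →L[ℂ] H)) ⁻¹' {x | ‖x‖ ≤ C}) := by
  rw [isCompact_iff_ultrafilter_le_nhds]
  intro F hF
  rw [le_principal_iff] at hF
  have hbd : ∀ v w : H, ∀ᶠ T in (F : Filter (H →WOT[ℂ] H)),
      inner ℂ (T v) w ∈ Metric.closedBall (0 : ℂ) (C * ‖v‖ * ‖w‖) := fun v w => by
    filter_upwards [hF] with T hT
    rw [mem_closedBall_zero_iff]
    refine (norm_inner_le_norm _ _).trans ?_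
    gcongr
    exact ContinuousLinearMap.le_of_opNorm_le T.toCLM hT v
  have hlim : ∀ v w : H, ∃ l : ℂ, ‖l‖ ≤ C * ‖v‖ * ‖w‖ ∧
      Tendsto (fun T : H →WOT[ℂ] H => inner ℂ (T v) w) F (𝓝 l) := fun v w => by
    obtain ⟨l, hl, h⟩ := (isCompact_closedBall (0 : ℂ) (C * ‖v‖ * ‖w‖)).ultrafilter_le_nhds
      (F.map fun T => inner ℂ (T v) w) (by rw [le_principal_iff]; exact hbd v w)
    exact ⟨l, by simpa using hl, h⟩
  choose l hl hlt using hlim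
  let B₀ : H →ₗ⋆[ℂ] H →ₗ[ℂ] ℂ := LinearMap.mk₂'ₛₗ (starRingEnd ℂ) (RingHom.id ℂ) l
    (fun v v' w => tendsto_nhds_unique (hlt _ _)
      (((hlt v w).add (hlt v' w)).congr fun T => by rw [map_add, inner_add_left]))
    (fun c v w => tendsto_nhds_unique (hlt _ _)
      (((hlt v w).const_mul _).congr fun T => by rw [map_smul, inner_smul_left]))
    (fun v w w' => tendsto_nhds_unique (hlt _ _)
      (((hlt v w).add (hlt v w')).congr fun T => by rw [inner_add_right]))
    (fun c v w => tendsto_nhds_unique (hlt _ _)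
      (((hlt v w).const_mul _).congr fun T => by rw [inner_smul_right]; rfl))
  let B : H →L⋆[ℂ] H →L[ℂ] ℂ := B₀.mkContinuous₂ C fun v w => hl v w
  let T₀ := InnerProductSpace.continuousLinearMapOfBilin B
  have hT₀ : ∀ v w, inner ℂ (T₀ v) w = l v w := fun v w =>
    InnerProductSpace.continuousLinearMapOfBilin_apply B v w
  have hle : (F : Filter (H →WOT[ℂ] H)) ≤ 𝓝 (ofCLM T₀) := by
    refine le_nhds_iff_forall_inner_apply_le_nhds.2 fun v w => ?_
    have h := (Complex.continuous_conj.tendsto _).comp (hlt v w)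
    rw [← hT₀, inner_conj_symm] at h
    refine Tendsto.congr (fun T => ?_) h
    simp
  exact ⟨ofCLM T₀, (isWOTClosed_closedBall C).mem_of_tendsto hle hF, hle⟩

theorem IsWOTClosed.isCompact {S : Set (H →L[ℂ] H)} (hS : IsWOTClosed S) {C : ℝ}
    (hC : ∀ x ∈ S, ‖x‖ ≤ C) : IsCompact ((toCLM : (H →WOT[ℂ] H) → (H →L[ℂ] H)) ⁻¹' S) :=
  (isCompact_wot_closedBall C).of_isClosed_subset hS fun _ hx => hC _ hx

/-- A decreasing sequence of nonempty bounded WOT-closed sets has nonempty intersection. -/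
theorem exists_mem_forall_of_antitone {S : ℕ → Set (H →L[ℂ] H)} (hS : Antitone S)
    (hne : ∀ n, (S n).Nonempty) (hc : ∀ n, IsWOTClosed (S n)) {C : ℝ}
    (hC : ∀ x ∈ S 0, ‖x‖ ≤ C) : ∃ x, ∀ n, x ∈ S n := by
  obtain ⟨x, hx⟩ := IsCompact.nonempty_iInter_of_sequence_nonempty_isCompact_isClosed
    (fun n => (toCLM : (H →WOT[ℂ] H) → (H →L[ℂ] H)) ⁻¹' S n)
    (fun n _ hx => hS (Nat.le_succ n) hx) (fun n => let ⟨x, hx⟩ := hne n; ⟨ofCLM x, hx⟩)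
    ((hc 0).isCompact hC) hc
  exact ⟨x.toCLM, fun n => Set.mem_iInter.1 hx n⟩

theorem isWOTClosed_setOf_eq {f g : (H →L[ℂ] H) → (H →L[ℂ] H)}
    (hf : Continuous fun x : H →WOT[ℂ] H => (ofCLM (f x.toCLM) : H →WOT[ℂ] H))
    (hg : Continuous fun x : H →WOT[ℂ] H => (ofCLM (g x.toCLM) : H →WOT[ℂ] H)) :
    IsWOTClosed {x : H →L[ℂ] H | f x = g x} := by
  have h : (toCLM : (H →WOT[ℂ] H) → (H →L[ℂ] H)) ⁻¹' {x | f x = g x} =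
      {x | (ofCLM (f x.toCLM) : H →WOT[ℂ] H) = ofCLM (g x.toCLM)} := by
    ext x; exact (ofCLM_injective.eq_iff).symm
  rw [IsWOTClosed, h]
  exact isClosed_eq hf hg

theorem isWOTClosed_centralizer (S : Set (H →L[ℂ] H)) :
    IsWOTClosed (Set.centralizer S) := by
  have h : (toCLM : (H →WOT[ℂ] H) → (H →L[ℂ] H)) ⁻¹' Set.centralizer S =
      ⋂ a ∈ S, toCLM ⁻¹' {x | a * x = x * a} := by
    ext x; simp [Set.mem_centralizer_iff]
  rw [IsWOTClosed, h]
  exact isClosed_biInter fun a _ =>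
    isWOTClosed_setOf_eq (continuous_mul_left_wot a) (continuous_mul_right_wot a)

theorem isWOTClosed_coe (M : VonNeumannAlgebra H) : IsWOTClosed (M : Set (H →L[ℂ] H)) := by
  rw [← M.centralizer_centralizer]; exact isWOTClosed_centralizer _

theorem IsWOTClosed.isClosed {S : Set (H →L[ℂ] H)} (hS : IsWOTClosed S) : IsClosed S := by
  have : Continuous (ofCLM : (H →L[ℂ] H) → (H →WOT[ℂ] H)) := by
    refine continuous_iff.2 fun ξ η => ?_
    simp only [ofCLM_apply]
    fun_prop
  exact IsClosed.preimage this hS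

/-! ### Weakly closed convex hulls -/

theorem isWOTClosed_weakClosedConvexHull (S : Set (H →L[ℂ] H)) :
    IsWOTClosed (weakClosedConvexHull S) :=
  isClosed_closure

theorem subset_weakClosedConvexHull (S : Set (H →L[ℂ] H)) : S ⊆ weakClosedConvexHull S :=
  fun x hx => subset_closure ⟨x, subset_convexHull ℝ S hx, rfl⟩

theorem convex_weakClosedConvexHull (S : Set (H →L[ℂ] H)) :
    Convex ℝ (weakClosedConvexHull S) := by
  have h : Convex ℝ (closure ((linearEquiv (σ := RingHom.id ℂ) (E := H) (F := H) ℝ).symm ''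
      convexHull ℝ S)) :=
    ((convex_convexHull ℝ S).linear_image
      (linearEquiv (σ := RingHom.id ℂ) (E := H) (F := H) ℝ).symm.toLinearMap).closure
  exact h.linear_preimage (linearEquiv (σ := RingHom.id ℂ) (E := H) (F := H) ℝ).symm.toLinearMap

theorem weakClosedConvexHull_min {S T : Set (H →L[ℂ] H)} (hST : S ⊆ T) (hT : Convex ℝ T)
    (hc : IsWOTClosed T) : weakClosedConvexHull S ⊆ T := by
  have h : closure ((ofCLM : (H →L[ℂ] H) → (H →WOT[ℂ] H)) '' convexHull ℝ S) ⊆ toCLM ⁻¹' T := by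
    refine closure_minimal ?_ hc
    rintro _ ⟨x, hx, rfl⟩
    exact convexHull_min hST hT hx
  exact fun x hx => h (show ofCLM x ∈ _ from hx)

theorem smul_mem_coe (M : VonNeumannAlgebra H) (c : ℂ) {x : H →L[ℂ] H} (hx : x ∈ M) :
    c • x ∈ M :=
  M.toStarSubalgebra.smul_mem hx c

theorem real_smul_mem_coe (M : VonNeumannAlgebra H) (c : ℝ) {x : H →L[ℂ] H} (hx : x ∈ M) :
    c • x ∈ M := by
  have h : c • x = (c : ℂ) • x := by ext; simp
  rw [h]; exact M.smul_mem_coe _ hx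

theorem convex_coe (M : VonNeumannAlgebra H) : Convex ℝ (M : Set (H →L[ℂ] H)) :=
  fun _ hx _ hy a b _ _ _ => add_mem (M.real_smul_mem_coe a hx) (M.real_smul_mem_coe b hy)

theorem continuous_conj_add_wot (a b c : H →L[ℂ] H) :
    Continuous fun x : H →WOT[ℂ] H => (ofCLM (a * x.toCLM * b + c) : H →WOT[ℂ] H) :=
  ((continuous_mul_right_wot b).comp (continuous_mul_left_wot a)).add continuous_const

theorem isWOTClosed_setOf_conj_eq (a b c d : H →L[ℂ] H) :
    IsWOTClosed {x : H →L[ℂ] H | a * x * b = c * x * d} := by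
  refine isWOTClosed_setOf_eq ?_ ?_
  · simpa only [add_zero] using continuous_conj_add_wot a b 0
  · simpa only [add_zero] using continuous_conj_add_wot c d 0

theorem convex_setOf_conj_eq (a b c d : H →L[ℂ] H) :
    Convex ℝ {x : H →L[ℂ] H | a * x * b = c * x * d} := by
  intro x hx y hy s t _ _ _
  simp only [Set.mem_ofPred_eq] at *
  simp only [mul_add, add_mul, mul_smul_comm, smul_mul_assoc, hx, hy]

/-- Affine maps `y ↦ a y b + c` respect weakly closed convex hulls. -/
theorem conj_add_mem_of_mem_weakClosedConvexHull {S K : Set (H →L[ℂ] H)} (a b c : H →L[ℂ] H)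
    (hK : Convex ℝ K) (hc : IsWOTClosed K) (h : ∀ y ∈ S, a * y * b + c ∈ K)
    {y : H →L[ℂ] H} (hy : y ∈ weakClosedConvexHull S) : a * y * b + c ∈ K := by
  refine weakClosedConvexHull_min (T := {y | a * y * b + c ∈ K}) h ?_ ?_ hy
  · intro x hx z hz s t hs ht hst
    have h1 := hK hx hz hs ht hst
    have h2 : a * (s • x + t • z) * b + c = s • (a * x * b + c) + t • (a * z * b + c) := by
      have : c = s • c + t • c := by rw [← add_smul, hst, one_smul]
      conv_lhs => rw [this]
      simp only [mul_add, add_mul, mul_smul_comm, smul_mul_assoc, smul_add]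
      abel
    rw [Set.mem_ofPred_eq, h2]; exact h1
  · exact IsClosed.preimage (continuous_conj_add_wot a b c) hc

/-! ### Averaging over unitaries commuting with a projection -/

/-- The unitaries of `M` that commute with `p`. For a projection `p ∈ M`, compressing by `p` maps
them onto the unitary group of the corner `p M p`. -/
def reducingUnitaries (M : VonNeumannAlgebra H) (p : H →L[ℂ] H) : Submonoid (H →L[ℂ] H) where
  carrier := {u | u ∈ M ∧ (star u * u = 1 ∧ u * star u = 1) ∧ u * p = p * u}
  one_mem' := ⟨one_mem M, by simp, by simp⟩
  mul_mem' := by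
    rintro u v ⟨hu, ⟨hu1, hu2⟩, hu3⟩ ⟨hv, ⟨hv1, hv2⟩, hv3⟩
    refine ⟨mul_mem hu hv, ⟨?_, ?_⟩, ?_⟩
    · rw [star_mul, mul_assoc, ← mul_assoc (star u), hu1, one_mul, hv1]
    · rw [star_mul, mul_assoc, ← mul_assoc v, hv2, one_mul, hu2]
    · rw [mul_assoc, hv3, ← mul_assoc, hu3, mul_assoc]

/-- The weakly closed convex hull of the conjugates of `x` by the unitaries of `M` commuting
with `p`. -/
def averages (M : VonNeumannAlgebra H) (p x : H →L[ℂ] H) : Set (H →L[ℂ] H) :=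
  weakClosedConvexHull {y | ∃ u ∈ M.reducingUnitaries p, y = u * x * star u}

section averages

variable {M : VonNeumannAlgebra H} {p x y : H →L[ℂ] H}

theorem averages_subset {K : Set (H →L[ℂ] H)} (hK : Convex ℝ K) (hc : IsWOTClosed K)
    (h : ∀ u ∈ M.reducingUnitaries p, u * x * star u ∈ K) : M.averages p x ⊆ K :=
  weakClosedConvexHull_min (by rintro _ ⟨u, hu, rfl⟩; exact h u hu) hK hc

theorem convex_averages : Convex ℝ (M.averages p x) := convex_weakClosedConvexHull _

theorem isWOTClosed_averages : IsWOTClosed (M.averages p x) := isWOTClosed_weakClosedConvexHull _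

theorem conj_mem_averages_self {u : H →L[ℂ] H} (hu : u ∈ M.reducingUnitaries p) :
    u * x * star u ∈ M.averages p x :=
  subset_weakClosedConvexHull _ ⟨u, hu, rfl⟩

theorem self_mem_averages : x ∈ M.averages p x := by
  simpa using conj_mem_averages_self (M := M) (p := p) (x := x) (one_mem _)

theorem conj_mem_averages {u : H →L[ℂ] H} (hu : u ∈ M.reducingUnitaries p)
    (hy : y ∈ M.averages p x) : u * y * star u ∈ M.averages p x := by
  have := conj_add_mem_of_mem_weakClosedConvexHull u (star u) 0 convex_averages
    (isWOTClosed_averages (M := M) (p := p) (x := x)) ?_ hy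
  · simpa using this
  · rintro _ ⟨v, hv, rfl⟩
    have := conj_mem_averages_self (x := x) (mul_mem hu hv)
    rw [star_mul] at this
    simpa [mul_assoc] using this

theorem averages_subset_of_mem (hy : y ∈ M.averages p x) : M.averages p y ⊆ M.averages p x :=
  averages_subset convex_averages isWOTClosed_averages fun _ hu => conj_mem_averages hu hy

theorem norm_conj_le {u : H →L[ℂ] H} (hu : star u * u = 1) (x : H →L[ℂ] H) :
    ‖u * x * star u‖ ≤ ‖x‖ := by
  have h1 : ‖u‖ ≤ 1 := by
    have h : ‖u‖ * ‖u‖ ≤ 1 := by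
      rw [← CStarRing.norm_star_mul_self, hu]; exact ContinuousLinearMap.norm_id_le
    nlinarith [norm_nonneg u]
  calc ‖u * x * star u‖ ≤ ‖u‖ * ‖x‖ * ‖star u‖ :=
        (norm_mul_le _ _).trans (by gcongr; exact norm_mul_le _ _)
    _ ≤ 1 * ‖x‖ * 1 := by rw [norm_star]; gcongr
    _ = ‖x‖ := by ring

theorem norm_le_of_mem_averages (hy : y ∈ M.averages p x) : ‖y‖ ≤ ‖x‖ := by
  refine averages_subset (K := {y | ‖y‖ ≤ ‖x‖}) ?_ (isWOTClosed_closedBall _)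
    (fun u hu => norm_conj_le hu.2.1.1 x) hy
  have h : {y : H →L[ℂ] H | ‖y‖ ≤ ‖x‖} = Metric.closedBall 0 ‖x‖ := by ext; simp
  rw [h]
  exact convex_closedBall _ _

theorem averages_subset_coe {N : VonNeumannAlgebra H} (hMN : M ≤ N) (hx : x ∈ N) :
    M.averages p x ⊆ N :=
  averages_subset N.convex_coe N.isWOTClosed_coe fun _ hu =>
    mul_mem (mul_mem (hMN hu.1) hx) (star_mem (hMN hu.1))

theorem star_mul_comm_of_mem {u : H →L[ℂ] H} (hu : u ∈ M.reducingUnitaries p) :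
    star u * p = p * star u := by
  calc star u * p = star u * (p * u) * star u := by
        rw [mul_assoc, mul_assoc, hu.2.1.2, mul_one]
    _ = p * star u := by rw [← hu.2.2, ← mul_assoc, hu.2.1.1, one_mul]

theorem corner_of_mem_averages (hx : x = p * x * p) (hy : y ∈ M.averages p x) :
    y = p * y * p := by
  have := averages_subset (K := {y | 1 * y * 1 = p * y * p}) (convex_setOf_conj_eq _ _ _ _)
    (isWOTClosed_setOf_conj_eq _ _ _ _) (fun u hu => ?_) hy
  · simpa using this
  · rw [Set.mem_ofPred_eq, one_mul, mul_one]
    conv_lhs => rw [hx]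
    simp only [← mul_assoc]
    rw [hu.2.2, mul_assoc _ p, ← star_mul_comm_of_mem hu]
    simp only [← mul_assoc]

end averages

/-- Mean-value ergodicity of the corner inclusion `p M p ⊆ p N p`, expressed by the unitaries
of `M` commuting with `p`. -/
def IsMVErgodicAt (M N : VonNeumannAlgebra H) (p : H →L[ℂ] H) : Prop :=
  ∀ x ∈ N, x = p * x * p → ∃ c : ℂ, c • p ∈ M.averages p x

theorem IsMVErgodicAt.mvErgodicWithUnit {M N : VonNeumannAlgebra H} {p : H →L[ℂ] H}
    (hpN : p ∈ N) (hp : IsStarProjection p) (h : M.IsMVErgodicAt N p) :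
    MVErgodicWithUnit p (corner p M) (corner p N) := by
  have hpp : p * p = p := hp.isIdempotentElem
  have hps : star p = p := hp.isSelfAdjoint
  rintro _ ⟨x, hx, rfl⟩
  obtain ⟨c, hc⟩ := h (p * x * p) (mul_mem (mul_mem hpN hx) hpN) (by
    simp only [mul_assoc, hpp]; simp only [← mul_assoc, hpp])
  refine ⟨c, averages_subset (convex_weakClosedConvexHull _) (isWOTClosed_weakClosedConvexHull _)
    (fun u hu => subset_weakClosedConvexHull _ ?_) hc⟩
  have hus := star_mul_comm_of_mem hu
  obtain ⟨huM, ⟨hu1, hu2⟩, hup⟩ := hu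
  have h1 : p * u * p = u * p := by rw [← hup, mul_assoc, hpp]
  have h2 : star (p * u * p) = p * star u := by rw [h1, star_mul, hps]
  refine ⟨p * u * p, ⟨u, huM, rfl⟩, ?_, ?_, ?_⟩
  · rw [h2, h1, mul_assoc, ← mul_assoc (star u), hu1, one_mul, hpp]
  · rw [h2, h1, mul_assoc, ← mul_assoc p p, hpp, ← hus, ← mul_assoc, hu2, one_mul]
  · rw [h2, h1]
    simp only [mul_assoc]
    rw [← mul_assoc p p, hpp, ← mul_assoc p p, hpp]

theorem isMVErgodic_of_isMVErgodicAt_one {M N : VonNeumannAlgebra H} (h : M.IsMVErgodicAt N 1) :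
    M.IsMVErgodic N := by
  intro x hx
  obtain ⟨c, hc⟩ := h x hx (by simp)
  have hsub : ∀ u ∈ M.reducingUnitaries 1,
      u * x * star u ∈ unitaryOrbit 1 (M : Set (H →L[ℂ] H)) x :=
    fun u hu => ⟨u, hu.1, hu.2.1.1, hu.2.1.2, rfl⟩
  exact ⟨c, averages_subset (convex_weakClosedConvexHull _) (isWOTClosed_weakClosedConvexHull _)
    (fun u hu => subset_weakClosedConvexHull _ (hsub u hu)) hc⟩

/-- A mean-value ergodic inclusion is ergodic, as averaging fixes the relative commutant. -/
theorem IsMVErgodic.isErgodic {M N : VonNeumannAlgebra H} (h : M.IsMVErgodic N) :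
    M.IsErgodic N := by
  apply Set.Subset.antisymm
  · rintro x ⟨hxM, hxN⟩
    obtain ⟨c, hc⟩ := h x hxN
    refine ⟨c, ?_⟩
    have hsub : unitaryOrbit 1 (M : Set (H →L[ℂ] H)) x ⊆ {x} := by
      rintro _ ⟨u, hu, -, hu2, rfl⟩
      rw [Set.mem_singleton_iff, mem_commutant_iff.1 hxM u hu, mul_assoc, hu2, mul_one]
    exact weakClosedConvexHull_min hsub (convex_singleton x)
      (isWOTClosed_setOf_eq continuous_id continuous_const) hc
  · rintro _ ⟨c, rfl⟩
    refine ⟨?_, N.smul_mem_coe c (one_mem N)⟩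
    exact (M.commutant).smul_mem_coe c (one_mem M.commutant)

/-! ### Projections and comparison -/

/-- An operator that leaves a closed subspace invariant, together with its adjoint, commutes with
the projection onto the subspace. -/
theorem starProjection_commute {K : Submodule ℂ H} [K.HasOrthogonalProjection]
    {z : H →L[ℂ] H} (h : ∀ ξ ∈ K, z ξ ∈ K) (h' : ∀ ξ ∈ K, star z ξ ∈ K) :
    z * K.starProjection = K.starProjection * z := by
  have key : ∀ w : H →L[ℂ] H, (∀ ξ ∈ K, w ξ ∈ K) →
      K.starProjection * w * K.starProjection = w * K.starProjection := fun w hw => by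
    ext ξ
    exact Submodule.starProjection_eq_self_iff.2 (hw _ (K.starProjection_apply_mem ξ))
  have hs : star K.starProjection = K.starProjection :=
    (isStarProjection_starProjection (U := K)).isSelfAdjoint
  have h1 := congrArg star (key _ h')
  simp only [star_mul, star_star, hs] at h1
  rw [← key z h, mul_assoc, h1]

/-- A self-adjoint operator has a spectral projection for `(0, ∞)`, lying in its bicommutant. -/
theorem exists_spectral_projection {a : H →L[ℂ] H} (ha : IsSelfAdjoint a) :
    ∃ r : H →L[ℂ] H, IsStarProjection r ∧ (∀ z, z * a = a * z → z * r = r * z) ∧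
      0 ≤ a * r ∧ a * (1 - r) ≤ 0 := by
  let K : Submodule ℂ H := (a⁺ : H →L[ℂ] H).ker
  have : CompleteSpace K := (ContinuousLinearMap.isClosed_ker (a⁺)).completeSpace_coe
  let q := K.starProjection
  have hq : IsStarProjection q := isStarProjection_starProjection
  have h0 : a⁺ * q = 0 := by
    ext ξ; exact LinearMap.mem_ker.1 (K.starProjection_apply_mem ξ)
  have hpos : 0 ≤ a⁺ := CFC.posPart_nonneg a
  have hneg : 0 ≤ a⁻ := CFC.negPart_nonneg a
  have h1 : q * a⁻ = a⁻ := by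
    ext ξ
    refine Submodule.starProjection_eq_self_iff.2 (LinearMap.mem_ker.2 ?_)
    exact congrArg (fun T : H →L[ℂ] H => T ξ) (CFC.posPart_mul_negPart a)
  have h2 : a⁻ * q = a⁻ := by
    have := congrArg star h1
    rwa [star_mul, (IsSelfAdjoint.of_nonneg hneg).star_eq, hq.isSelfAdjoint.star_eq] at this
  have h3 : a * q = -a⁻ := by
    conv_lhs => rw [← CFC.posPart_sub_negPart a ha]
    rw [sub_mul, h0, h2, zero_sub]
  refine ⟨1 - q, hq.one_sub, fun z hz => ?_, ?_, ?_⟩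
  · have hpart : ∀ z : H →L[ℂ] H, z * a = a * z → z * a⁺ = a⁺ * z := fun z hz => by
      rw [CFC.posPart_def]
      exact (Commute.cfcₙ_real (show Commute a z from hz.symm) _).symm.eq
    have hinv : ∀ z : H →L[ℂ] H, z * a = a * z → ∀ ξ ∈ K, z ξ ∈ K := fun z hz ξ hξ => by
      refine LinearMap.mem_ker.2 ?_
      have := congrArg (fun T : H →L[ℂ] H => T ξ) (hpart z hz)
      have hξ' : a⁺ ξ = 0 := LinearMap.mem_ker.1 hξ
      simp only [mul_apply_eq_comp, hξ', map_zero] at this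
      exact this.symm
    have hz' : star z * a = a * star z := by
      have := congrArg star hz
      rw [star_mul, star_mul, ha.star_eq] at this
      exact this.symm
    have := starProjection_commute (hinv z hz) (hinv _ hz')
    rw [mul_sub, sub_mul, mul_one, one_mul, this]
  · rw [mul_sub, mul_one, h3, sub_neg_eq_add]
    nth_rewrite 1 [← CFC.posPart_sub_negPart a ha]
    simpa using hpos
  · rw [sub_sub_cancel, h3]; simpa using hneg

theorem mem_of_forall_commute {M : VonNeumannAlgebra H} {r : H →L[ℂ] H}
    (h : ∀ z ∈ M.commutant, z * r = r * z) : r ∈ M := by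
  rw [← M.commutant_commutant]; exact mem_commutant_iff.2 h

theorem eq_zero_or_one_smul (p : H →L[ℂ] H) (hp : IsStarProjection p) (c : ℂ)
    (h : p = c • (1 : H →L[ℂ] H)) : p = 0 ∨ p = 1 := by
  by_cases h0 : p = 0
  · exact Or.inl h0
  · right
    have h1 : p * p = c • p := by nth_rewrite 1 [h]; simp
    rw [hp.isIdempotentElem.eq] at h1
    have : (1 - c) • p = 0 := by rw [sub_smul, one_smul, ← h1, sub_self]
    rcases smul_eq_zero.1 this with h2 | h2
    · rw [h, ← sub_eq_zero.1 h2, one_smul]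
    · exact absurd h2 h0

/-- Nonzero projections `e`, `f` in a factor satisfy `f M e ≠ 0`. -/
theorem IsFactor.eq_zero_or_eq_zero {M : VonNeumannAlgebra H} (hM : M.IsFactor)
    {e f : H →L[ℂ] H} (hf : f ∈ M) (h : ∀ x ∈ M, f * x * e = 0) :
    e = 0 ∨ f = 0 := by
  let K : Submodule ℂ H := ⨅ x : M, (f * (x : H →L[ℂ] H)).ker
  have hK : ∀ ξ, ξ ∈ K ↔ ∀ x ∈ M, f (x ξ) = 0 := fun ξ => by
    simp [K, Submodule.mem_iInf]
  have hcl : IsClosed (K : Set H) := by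
    simp only [K, Submodule.coe_iInf]
    exact isClosed_iInter fun x => ContinuousLinearMap.isClosed_ker _
  have : CompleteSpace K := hcl.completeSpace_coe
  have hinv : ∀ z ∈ M, ∀ ξ ∈ K, z ξ ∈ K := fun z hz ξ hξ =>
    (hK _).2 fun x hx => (hK ξ).1 hξ (x * z) (mul_mem hx hz)
  have hinv' : ∀ z ∈ M.commutant, ∀ ξ ∈ K, z ξ ∈ K := fun z hz ξ hξ =>
    (hK _).2 fun x hx => by
      have h1 := congrArg (fun T : H →L[ℂ] H => T ξ)
        (mem_commutant_iff.1 hz (f * x) (mul_mem hf hx))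
      simp only [mul_apply_eq_comp, (hK ξ).1 hξ x hx, map_zero] at h1
      exact h1
  have hq1 : K.starProjection ∈ M := mem_of_forall_commute fun z hz =>
    starProjection_commute (hinv' z hz) (hinv' _ (star_mem hz))
  have hq2 : K.starProjection ∈ M.commutant := mem_commutant_iff.2 fun z hz =>
    starProjection_commute (hinv z hz) (hinv _ (star_mem hz))
  obtain ⟨c, hc⟩ := hM.2 _ hq1 hq2
  have he' : K.starProjection * e = e := by
    ext ξ
    refine Submodule.starProjection_eq_self_iff.2 ((hK _).2 fun x hx => ?_)
    exact congrArg (fun T : H →L[ℂ] H => T ξ) (h x hx)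
  have hf' : f * K.starProjection = 0 := by
    ext ξ
    exact (hK _).1 (K.starProjection_apply_mem ξ) 1 (one_mem M)
  rcases eq_zero_or_one_smul _ isStarProjection_starProjection c hc with h0 | h1
  · left; rw [← he', h0, zero_mul]
  · right; rw [h1, mul_one] at hf'; exact hf'

theorem norm_le_one_iff_star_mul_le (x : H →L[ℂ] H) : ‖x‖ ≤ 1 ↔ star x * x ≤ 1 := by
  rw [← CStarAlgebra.norm_le_one_iff_of_nonneg _ (star_mul_self_nonneg x),
    CStarRing.norm_star_mul_self]
  constructor
  · intro h; nlinarith [norm_nonneg x]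
  · intro h; nlinarith [norm_nonneg x]

/-- Both signs satisfy `‖v (1 ± (1 - v⋆v)/2)‖ ≤ 1` for a contraction `v`: the polynomials
`1 - t (1 ± (1 - t)/2)²` are nonnegative on `[0, 1]`. -/
theorem norm_mul_one_add_le {v : H →L[ℂ] H} (hv : ‖v‖ ≤ 1) {ε : ℝ} (hε : ε = 1 ∨ ε = -1) :
    ‖v + (ε / 2) • (v * (1 - star v * v))‖ ≤ 1 := by
  rw [norm_le_one_iff_star_mul_le]
  set a := star v * v with ha
  have ha0 : 0 ≤ a := star_mul_self_nonneg v
  have ha1 : 0 ≤ 1 - a := sub_nonneg.2 ((norm_le_one_iff_star_mul_le v).1 hv)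
  have has : star a = a := (IsSelfAdjoint.of_nonneg ha0).star_eq
  have h1s : star (1 - a) = 1 - a := by rw [star_sub, star_one, has]
  have hA : 0 ≤ (1 - a) * a * (1 - a) := by
    simpa only [h1s] using star_left_conjugate_nonneg ha0 (1 - a)
  have hB : 0 ≤ a * (1 - a) * a := by
    simpa only [has] using star_left_conjugate_nonneg ha1 a
  have hC : 0 ≤ (1 - a) * (1 - a) * (1 - a) := by
    simpa only [h1s] using star_left_conjugate_nonneg ha1 (1 - a)
  have hD : 0 ≤ (1 - a) * (1 - a) := by
    have := star_mul_self_nonneg (1 - a); rwa [h1s] at this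
  have e1 : star (v + (ε / 2) • (v * (1 - a))) * (v + (ε / 2) • (v * (1 - a))) =
      a + (ε / 2) • (a * (1 - a)) + (ε / 2) • ((1 - a) * a) +
        (ε / 2) • (ε / 2) • ((1 - a) * a * (1 - a)) := by
    have hs : star (v + (ε / 2) • (v * (1 - a))) = star v + (ε / 2) • ((1 - a) * star v) := by
      rw [star_add, star_smul, star_mul, h1s, star_trivial (ε / 2)]
    rw [hs]
    simp only [add_mul, mul_add, smul_mul_assoc, mul_smul_comm, smul_add]
    rw [ha]
    simp only [mul_assoc]
    abel
  rw [← sub_nonneg, e1]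
  rcases hε with rfl | rfl
  · have : 1 - (a + ((1 : ℝ) / 2) • (a * (1 - a)) + ((1 : ℝ) / 2) • ((1 - a) * a) +
        ((1 : ℝ) / 2) • ((1 : ℝ) / 2) • ((1 - a) * a * (1 - a))) =
        (1 / 4 : ℝ) • ((1 - a) * (1 - a) * (1 - a)) + (3 / 4 : ℝ) • ((1 - a) * (1 - a)) := by
      simp only [mul_sub, sub_mul, mul_one, one_mul, smul_sub, smul_smul]
      module
    rw [this]
    positivity
  · have : 1 - (a + ((-1 : ℝ) / 2) • (a * (1 - a)) + ((-1 : ℝ) / 2) • ((1 - a) * a) +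
        ((-1 : ℝ) / 2) • ((-1 : ℝ) / 2) • ((1 - a) * a * (1 - a))) =
        (1 - a) + (3 / 4 : ℝ) • ((1 - a) * a * (1 - a)) + a * (1 - a) * a := by
      simp only [mul_sub, sub_mul, mul_one, one_mul, smul_sub, smul_smul]
      module
    rw [this]
    positivity

/-- Midpoint form of the Krein–Milman theorem: a nonempty convex bounded WOT-closed set contains
an element that is not the midpoint of a nontrivial segment in the set. -/
theorem exists_forall_add_sub_mem {S : Set (H →L[ℂ] H)} (hc : IsWOTClosed S) {C : ℝ}
    (hC : ∀ x ∈ S, ‖x‖ ≤ C) (hne : S.Nonempty) :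
    ∃ v ∈ S, ∀ d, v + d ∈ S → v - d ∈ S → d = 0 := by
  obtain ⟨v, hv⟩ := (hc.isCompact hC).extremePoints_nonempty
    (let ⟨x, hx⟩ := hne; ⟨ofCLM x, hx⟩)
  rw [mem_extremePoints] at hv
  refine ⟨v.toCLM, hv.1, fun d hd hd' => ?_⟩
  have h := (hv.2 (ofCLM (v.toCLM + d)) hd (ofCLM (v.toCLM - d)) hd'
    ⟨1 / 2, 1 / 2, by norm_num, by norm_num, by norm_num, ?_⟩).1
  · have := congrArg toCLM h
    simpa using this
  · rw [ofCLM_add, ofCLM_sub, ofCLM_toCLM]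
    module

/-- Comparison of projections in a factor: one of `e`, `f` is equivalent to a subprojection of
the other. The partial isometry is an extreme point of the unit ball of `f M e`; extremality
forces `(f - vv⋆) M (e - v⋆v) = 0`. -/
theorem IsFactor.exists_partial_isometry {M : VonNeumannAlgebra H} (hM : M.IsFactor)
    {e f : H →L[ℂ] H} (he : e ∈ M) (hf : f ∈ M) (hep : IsStarProjection e)
    (hfp : IsStarProjection f) :
    ∃ v ∈ M, f * v = v ∧ v * e = v ∧ v * star v * v = v ∧ (star v * v = e ∨ v * star v = f) := by
  have hee : e * e = e := hep.isIdempotentElem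
  have hff : f * f = f := hfp.isIdempotentElem
  let S : Set (H →L[ℂ] H) := M ∩ {x | ‖x‖ ≤ 1} ∩ {x | f * x * e = 1 * x * 1}
  have hmem : ∀ x, x ∈ S ↔ x ∈ M ∧ ‖x‖ ≤ 1 ∧ f * x * e = x := fun x => by
    simp only [S, Set.mem_inter_iff, SetLike.mem_coe, Set.mem_ofPred_eq, one_mul, mul_one,
      and_assoc]
  obtain ⟨v, hv, hext⟩ := exists_forall_add_sub_mem (S := S)
    ((M.isWOTClosed_coe.inter (isWOTClosed_closedBall 1)).inter (isWOTClosed_setOf_conj_eq _ _ _ _))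
    (fun x hx => hx.1.2) ⟨0, (hmem 0).2 ⟨zero_mem M, by simp, by simp⟩⟩
  obtain ⟨hvM, hv1, hvc⟩ := (hmem v).1 hv
  have hfv : f * v = v := by
    conv_lhs => rw [← hvc]
    rw [← mul_assoc, ← mul_assoc, hff, hvc]
  have hve : v * e = v := by
    conv_lhs => rw [← hvc]
    rw [mul_assoc, hee, hvc]
  have hsM : star v ∈ M := star_mem hvM
  have hes : e * star v = star v := by
    have := congrArg star hve; rwa [star_mul, hep.isSelfAdjoint.star_eq] at this
  -- Otherwise `v` would be the midpoint of the contractions `v (1 ± (1 - v⋆v)/2)`.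
  have hvvv : v * star v * v = v := by
    have hdM : v * (1 - star v * v) ∈ M := mul_mem hvM (sub_mem (one_mem M) (mul_mem hsM hvM))
    have hd1 : f * (v * (1 - star v * v)) * e = v * (1 - star v * v) := by
      rw [← mul_assoc, hfv, mul_assoc, sub_mul, one_mul, mul_assoc, hve, mul_sub, mul_sub, hve,
        mul_one]
    have hin : ∀ ε : ℝ, ε = 1 ∨ ε = -1 → v + (ε / 2) • (v * (1 - star v * v)) ∈ S := fun ε hε =>
      (hmem _).2 ⟨add_mem hvM (M.real_smul_mem_coe _ hdM), norm_mul_one_add_le hv1 hε, by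
        rw [mul_add, add_mul, hvc, mul_smul_comm, smul_mul_assoc, hd1]⟩
    have h0 := hext ((1 / 2 : ℝ) • (v * (1 - star v * v))) (hin 1 (Or.inl rfl)) (by
      have := hin (-1) (Or.inr rfl)
      rwa [neg_div, neg_smul, ← sub_eq_add_neg] at this)
    have h1 := (smul_eq_zero.1 h0).resolve_left (by norm_num)
    rw [mul_sub, mul_one, ← mul_assoc, sub_eq_zero] at h1
    exact h1.symm
  have hsvs : star v * v * star v = star v := by
    have := congrArg star hvvv
    rwa [star_mul, star_mul, star_star, ← mul_assoc] at this
  refine ⟨v, hvM, hfv, hve, hvvv, ?_⟩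
  have key : ∀ y ∈ M, (f - v * star v) * y * (e - star v * v) = 0 := by
    intro y hy
    set x := (f - v * star v) * y * (e - star v * v) with hx
    have hxM : x ∈ M := mul_mem (mul_mem (sub_mem hf (mul_mem hvM hsM)) hy)
      (sub_mem he (mul_mem hsM hvM))
    have hfx : f * x = x := by
      rw [hx, ← mul_assoc, ← mul_assoc, mul_sub f, hff, ← mul_assoc f, hfv]
    have hxe : x * e = x := by
      rw [hx, mul_assoc, sub_mul e, hee, mul_assoc (star v), hve]
    have hvx : star v * x = 0 := by
      have h0 : star v * (f - v * star v) = 0 := by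
        have : star v * f = star v := by
          have := congrArg star hfv; rwa [star_mul, hfp.isSelfAdjoint.star_eq] at this
        rw [mul_sub, this, ← mul_assoc, hsvs, sub_self]
      rw [hx, ← mul_assoc, ← mul_assoc, h0, zero_mul, zero_mul]
    have hxv : star x * v = 0 := by
      have := congrArg star hvx
      rwa [star_mul, star_star, star_zero] at this
    have hxq : x * (1 - star v * v) = x := by
      have h0 : (e - star v * v) * (1 - star v * v) = e - star v * v := by
        have h1 : star v * v * (star v * v) = star v * v := by rw [← mul_assoc, hsvs]
        rw [mul_sub, mul_one, sub_mul, ← mul_assoc e, hes, h1, sub_self, sub_zero]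
      rw [hx, mul_assoc, h0]
    -- Perturbations by small multiples of `x`, being orthogonal to `v`, stay in the unit ball.
    have hball : ∀ c : ℝ, ‖c • x‖ ≤ 1 → v + c • x ∈ S := fun c hc => by
      refine (hmem _).2 ⟨add_mem hvM (M.real_smul_mem_coe c hxM), ?_, ?_⟩
      · rw [norm_le_one_iff_star_mul_le] at hc ⊢
        have h1 : star (v + c • x) * (v + c • x) = star v * v + star (c • x) * (c • x) := by
          simp only [star_add, star_smul, add_mul, mul_add, smul_mul_assoc, mul_smul_comm, hvx,
            hxv, smul_zero, add_zero, zero_add]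
        have h2 : star (c • x) * (c • x) =
            star (1 - star v * v) * (star (c • x) * (c • x)) * (1 - star v * v) := by
          rw [mul_assoc, mul_assoc, smul_mul_assoc, hxq, ← mul_assoc, ← star_mul, smul_mul_assoc,
            hxq]
        have h3 : star (1 - star v * v) = 1 - star v * v := by simp
        have h4 : (1 - star v * v) * (1 - star v * v) = 1 - star v * v := by
          rw [mul_sub, mul_one, sub_mul, one_mul, ← mul_assoc, hsvs, sub_self, sub_zero]
        have h5 := star_left_conjugate_le_conjugate hc (1 - star v * v)
        rw [← h2, mul_one, h3, h4] at h5
        rw [h1]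
        calc _ ≤ star v * v + (1 - star v * v) := by gcongr
          _ = 1 := by abel
      · rw [mul_add, add_mul, hvc, mul_smul_comm, smul_mul_assoc, hfx, hxe]
    let c : ℝ := (1 + ‖x‖)⁻¹
    have hc0 : 0 < c := by positivity
    have hcx : ‖c • x‖ ≤ 1 := by
      rw [norm_smul, Real.norm_of_nonneg hc0.le, inv_mul_le_iff₀ (by positivity)]
      linarith
    have h0 := hext (c • x) (hball c hcx) (by
      rw [sub_eq_add_neg, ← neg_smul]
      exact hball (-c) (by rwa [neg_smul, norm_neg]))
    exact (smul_eq_zero.1 h0).resolve_left hc0.ne'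
  rcases hM.eq_zero_or_eq_zero (sub_mem hf (mul_mem hvM hsM)) key with h | h
  · exact Or.inl (sub_eq_zero.1 h).symm
  · exact Or.inr (sub_eq_zero.1 h).symm

/-! ### Averaging inside a factor -/

theorem norm_le_of_le_of_le {a : H →L[ℂ] H} (ha : IsSelfAdjoint a) {s : ℝ} (hs : 0 ≤ s)
    (h1 : a ≤ s • 1) (h2 : -(s • 1) ≤ a) : ‖a‖ ≤ s := by
  rw [← Algebra.algebraMap_eq_smul_one] at h1
  rw [← neg_smul, ← Algebra.algebraMap_eq_smul_one] at h2
  rw [le_algebraMap_iff_spectrum_le] at h1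
  rw [algebraMap_le_iff_le_spectrum] at h2
  rw [← cfc_id' ℝ a]
  exact norm_cfc_le hs fun x hx => abs_le.2 ⟨h2 x hx, h1 x hx⟩

theorem le_smul_one_of_norm_le {b : H →L[ℂ] H} (hb : IsSelfAdjoint b) {s : ℝ} (h : ‖b‖ ≤ s) :
    b ≤ s • 1 := by
  refine hb.le_algebraMap_norm_self.trans ?_
  rw [Algebra.algebraMap_eq_smul_one]
  exact smul_le_smul_of_nonneg_right h zero_le_one

theorem mem_reducingUnitaries_conj_self {M : VonNeumannAlgebra H} {p u : H →L[ℂ] H}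
    (hu : u ∈ M.reducingUnitaries p) : u * p * star u = p := by
  rw [hu.2.2, mul_assoc, hu.2.1.2, mul_one]

/-- The averaging step when the negative part of `b` sits under the projection `q'` and `v` moves
`q'` below the support `q` of the positive part: the symmetry `u` exchanging `v⋆v` and `vv⋆`
moves the negative part of `b` on top of its positive part. -/
theorem exists_average_near_of_partial_isometry {M : VonNeumannAlgebra H} {p q q' b v : H →L[ℂ] H}
    (hq : IsStarProjection q) (hq' : IsStarProjection q') (hp : IsStarProjection p)
    (hqq : q * q' = 0) (hpq : q + q' = p) (hqM : q' ∈ M) (hvM : v ∈ M)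
    (hqv : q * v = v) (hvv : star v * v = q') (hvq : v * q' = v) (hb : IsSelfAdjoint b) {s : ℝ}
    (hs : 0 ≤ s) (hb1 : b ≤ s • q) (hb2 : -(s • q') ≤ b) :
    ∃ u ∈ M.reducingUnitaries p, ∃ t : ℝ,
      ‖(1 / 2 : ℝ) • (b + u * b * star u) - t • p‖ ≤ 3 / 4 * s := by
  have hqs := hq.isSelfAdjoint.star_eq
  have hqs' := hq'.isSelfAdjoint.star_eq
  have hq2 : q * q = q := hq.isIdempotentElem
  have hq2' : q' * q' = q' := hq'.isIdempotentElem
  have hqq' : q' * q = 0 := by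
    have := congrArg star hqq; rwa [star_mul, hqs, hqs', star_zero] at this
  have hsq : star v * q = star v := by
    have := congrArg star hqv; rwa [star_mul, hqs] at this
  have hqs : q' * star v = star v := by
    have := congrArg star hvq; rwa [star_mul, hqs'] at this
  have hq'v : q' * v = 0 := by rw [← hqv, ← mul_assoc, hqq', zero_mul]
  have hsq' : star v * q' = 0 := by rw [← hsq, mul_assoc, hqq, mul_zero]
  have hvv0 : v * v = 0 := by
    calc v * v = v * (q' * v) := by rw [← mul_assoc, hvq]
      _ = 0 := by rw [hq'v, mul_zero]
  have hss0 : star v * star v = 0 := by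
    rw [← star_mul, hvv0, star_zero]
  set e := v * star v with he
  have hev : e * v = v := by rw [he, mul_assoc, hvv, hvq]
  have hse : star v * e = star v := by rw [he, ← mul_assoc, hvv, hqs]
  have hve : v * e = 0 := by rw [he, ← mul_assoc, hvv0, zero_mul]
  have hes : e * star v = 0 := by rw [he, mul_assoc, hss0, mul_zero]
  have hee : e * e = e := by rw [he, ← mul_assoc, mul_assoc v, hvv, hvq]
  have heq' : e * q' = 0 := by rw [he, mul_assoc, hsq', mul_zero]
  have hq'e : q' * e = 0 := by rw [he, ← mul_assoc, hq'v, zero_mul]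
  have hqe : q * e = e := by rw [he, ← mul_assoc, hqv]
  have heq : e * q = e := by rw [he, mul_assoc, hsq]
  have hestar : star e = e := by rw [he, star_mul, star_star]
  let u := v + star v + (1 - q' - e)
  have hustar : star u = u := by
    simp only [u, star_add, star_sub, star_star, star_one, hqs', hestar]
    abel
  have huu : u * u = 1 := by
    simp only [u, mul_add, add_mul, mul_sub, sub_mul, mul_one, one_mul, hvv0, hss0, hvv, ← he, hvq,
      hqs, hq'v, hsq', hev, hse, hve, hes, hee, heq', hq'e, hq2']
    abel
  have hup : u * p = p * u := by
    rw [← hpq]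
    simp only [u, mul_add, add_mul, mul_sub, sub_mul, mul_one, one_mul, hvq, hqv,
      hqs, hq'v, hsq', hsq, heq', hq'e, hq2', hqe, heq, hqq, hqq']
    have h1 : v * q = 0 := by rw [← hvq, mul_assoc, hqq', mul_zero]
    have h2 : q * star v = 0 := by rw [← hqs, ← mul_assoc, hqq, zero_mul]
    rw [h1, h2]
    abel
  have huM : u ∈ M.reducingUnitaries p :=
    ⟨add_mem (add_mem hvM (star_mem hvM)) (sub_mem (sub_mem (one_mem M) hqM)
      (mul_mem hvM (star_mem hvM))), by rw [hustar]; exact ⟨huu, huu⟩, hup⟩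
  have huq' : u * q' * u = e := by
    have h1 : u * q' = v := by
      simp only [u, add_mul, sub_mul, one_mul, hvq, hsq', hq2', heq']; abel
    rw [h1]
    simp only [u, mul_add, mul_sub, mul_one, hvv0, ← he, hvq, hve]; abel
  have huq : u * q * u = p - e := by
    have h1 : u * p * u = p := by rw [hup, mul_assoc, huu, mul_one]
    rw [eq_sub_of_add_eq hpq, mul_sub, sub_mul, h1, huq']
  have hub1 : u * b * u ≤ s • (p - e) := by
    have := star_left_conjugate_le_conjugate hb1 u
    rwa [hustar, mul_smul_comm, smul_mul_assoc, huq] at this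
  have hub2 : -(s • e) ≤ u * b * u := by
    have := star_left_conjugate_le_conjugate hb2 u
    rwa [hustar, mul_neg, neg_mul, mul_smul_comm, smul_mul_assoc, huq'] at this
  have he0 : 0 ≤ e := mul_star_self_nonneg v
  have hq0 : 0 ≤ q' := hq'.nonneg
  have hqe0 : 0 ≤ q - e := by
    have h1 : IsStarProjection (q - e) := ⟨by
      rw [IsIdempotentElem, mul_sub, sub_mul, sub_mul, hq2, heq, hqe, hee]; abel, by
      rw [IsSelfAdjoint, star_sub, hq.isSelfAdjoint.star_eq, hestar]⟩
    exact h1.nonneg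
  have hp1 : 0 ≤ 1 - p := hp.one_sub.nonneg
  refine ⟨u, huM, s / 4, ?_⟩
  rw [hustar]
  refine norm_le_of_le_of_le ?_ (by positivity) ?_ ?_
  · have h1 : IsSelfAdjoint (u * b * u) := by
      rw [IsSelfAdjoint, star_mul, star_mul, hustar, hb.star_eq, mul_assoc]
    exact ((IsSelfAdjoint.all (1 / 2 : ℝ)).smul (hb.add h1)).sub
      ((IsSelfAdjoint.all (s / 4)).smul hp.isSelfAdjoint)
  · rw [← sub_nonneg]
    have : (3 / 4 * s) • (1 : H →L[ℂ] H) - ((1 / 2 : ℝ) • (b + u * b * u) - (s / 4) • p) =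
        (1 / 2 : ℝ) • (s • q - b) + (1 / 2 : ℝ) • (s • (p - e) - u * b * u) +
          (s / 2) • e + (s / 2) • q' + (3 / 4 * s) • (1 - p) := by
      rw [← hpq]; module
    rw [this]
    have i1 := sub_nonneg.2 hb1
    have i2 := sub_nonneg.2 hub1
    positivity
  · rw [← sub_nonneg]
    have : (1 / 2 : ℝ) • (b + u * b * u) - (s / 4) • p - -((3 / 4 * s) • (1 : H →L[ℂ] H)) =
        (1 / 2 : ℝ) • (b - -(s • q')) + (1 / 2 : ℝ) • (u * b * u - -(s • e)) +
          (s / 2) • (q - e) + (3 / 4 * s) • (1 - p) := by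
      rw [← hpq]; module
    rw [this]
    have i1 := sub_nonneg.2 hb2
    have i2 := sub_nonneg.2 hub2
    positivity

/-- Dixmier's averaging step in a corner of a factor: by comparison, one of the supports of the
positive and negative parts of `a - t p` can be moved below the other, and a single symmetry shrinks
the distance to the scalars by the factor `3 / 4`. -/
theorem IsFactor.exists_average_near {M : VonNeumannAlgebra H} (hM : M.IsFactor)
    {p a : H →L[ℂ] H} (hpM : p ∈ M) (hp : IsStarProjection p) (haM : a ∈ M)
    (ha : IsSelfAdjoint a) (hpa : a = p * a * p) (t : ℝ) :
    ∃ u ∈ M.reducingUnitaries p, ∃ t' : ℝ,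
      ‖(1 / 2 : ℝ) • (a + u * a * star u) - t' • p‖ ≤ 3 / 4 * ‖a - t • p‖ := by
  have hpp : p * p = p := hp.isIdempotentElem
  have hps : star p = p := hp.isSelfAdjoint
  set b := a - t • p with hbdef
  have hbM : b ∈ M := sub_mem haM (M.real_smul_mem_coe t hpM)
  have hb : IsSelfAdjoint b := ha.sub ((IsSelfAdjoint.all t).smul hp.isSelfAdjoint)
  have hpb : p * b = b := by
    rw [hbdef, mul_sub, mul_smul_comm, hpp, hpa, ← mul_assoc, ← mul_assoc, hpp]
  have hbp : b * p = b := by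
    have := congrArg star hpb; rwa [star_mul, hb.star_eq, hps] at this
  suffices h : ∃ u ∈ M.reducingUnitaries p, ∃ t' : ℝ,
      ‖(1 / 2 : ℝ) • (b + u * b * star u) - t' • p‖ ≤ 3 / 4 * ‖b‖ by
    obtain ⟨u, hu, t', h⟩ := h
    refine ⟨u, hu, t' + t, ?_⟩
    have h1 : u * a * star u = u * b * star u + t • p := by
      rw [hbdef, mul_sub, sub_mul, mul_smul_comm, smul_mul_assoc,
        mem_reducingUnitaries_conj_self hu]
      abel
    have h2 : a = b + t • p := by rw [hbdef]; abel
    have h3 : (1 / 2 : ℝ) • (a + u * a * star u) - (t' + t) • p =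
        (1 / 2 : ℝ) • (b + u * b * star u) - t' • p := by
      rw [h1, h2]; module
    rw [h3]; exact h
  clear_value b
  obtain ⟨r, hr, hrc, hr1, hr2⟩ := exists_spectral_projection hb
  have hrr : r * r = r := hr.isIdempotentElem
  have hrs : star r = r := hr.isSelfAdjoint
  have hrM : r ∈ M := mem_of_forall_commute fun z hz => hrc z (mem_commutant_iff.1 hz b hbM).symm
  have hpr : p * r = r * p := hrc p (by rw [hpb, hbp])
  have hbr : b * r = r * b := (hrc b rfl)
  have hq : IsStarProjection (p * r) := ⟨by
    rw [IsIdempotentElem, hpr, mul_assoc, ← mul_assoc p, hpr, mul_assoc r p p, hpp, ← mul_assoc,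
      hrr], by
    rw [IsSelfAdjoint, star_mul, hps, hrs, hpr]⟩
  have hqq : p * r * (p - p * r) = 0 := by
    rw [mul_sub, hq.isIdempotentElem.eq, hpr, mul_assoc, hpp, sub_self]
  have hqq' : (p - p * r) * (p * r) = 0 := by
    rw [sub_mul, hq.isIdempotentElem.eq, ← mul_assoc, hpp, sub_self]
  have hq' : IsStarProjection (p - p * r) := ⟨by
    rw [IsIdempotentElem, mul_sub, hqq', sub_zero, sub_mul, mul_assoc, ← hpr, ← mul_assoc, hpp], by rw [IsSelfAdjoint, star_sub, hps, hq.isSelfAdjoint.star_eq]⟩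
  have hqM : p * r ∈ M := mul_mem hpM hrM
  have hqM' : p - p * r ∈ M := sub_mem hpM hqM
  have hb1 : b ≤ ‖b‖ • (p * r) := by
    have h1 : b ≤ b * r := by
      rw [← sub_nonneg]; have := neg_nonneg.2 hr2; rwa [mul_sub, mul_one, neg_sub] at this
    have h2 : b * r = star (p * r) * b * (p * r) := by
      rw [hq.isSelfAdjoint.star_eq, hpr, mul_assoc r, hpb, ← hbr, mul_assoc, ← mul_assoc r, hrr,
        ← hpr, ← mul_assoc, hbp]
    refine h1.trans ?_
    rw [h2]
    refine (star_left_conjugate_le_conjugate (le_smul_one_of_norm_le hb le_rfl) _).trans ?_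
    rw [mul_smul_comm, smul_mul_assoc, mul_one, hq.isSelfAdjoint.star_eq, hq.isIdempotentElem.eq]
  have hb2 : -(‖b‖ • (p - p * r)) ≤ b := by
    have h1 : b * (1 - r) ≤ b := by
      rw [← sub_nonneg, mul_sub, mul_one, sub_sub_cancel]; exact hr1
    have h2 : b * (1 - r) = star (p - p * r) * b * (p - p * r) := by
      rw [hq'.isSelfAdjoint.star_eq]
      have e1 : (p - p * r) * b = b * (1 - r) := by
        rw [sub_mul, hpb, hpr, mul_assoc, hpb, mul_sub b, mul_one, hbr]
      have e2 : (1 - r) * (p - p * r) = p - p * r := by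
        rw [sub_mul, one_mul, mul_sub, ← hpr, hpr, ← mul_assoc, hrr, sub_self, sub_zero]
      rw [e1, mul_assoc, e2, mul_sub b p, hbp, ← mul_assoc, hbp, mul_sub, mul_one]
    refine le_trans ?_ h1
    rw [h2]
    have h3 : -(‖b‖ • 1) ≤ b := by
      have := le_smul_one_of_norm_le hb.neg (norm_neg b).le
      exact neg_le_of_neg_le this
    refine le_trans ?_ (star_left_conjugate_le_conjugate h3 _)
    rw [mul_neg, neg_mul, mul_smul_comm, smul_mul_assoc, mul_one, hq'.isSelfAdjoint.star_eq,
      hq'.isIdempotentElem.eq]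
  obtain ⟨v, hvM, hfv, hve, -, hv | hv⟩ := hM.exists_partial_isometry hqM' hqM hq' hq
  · exact exists_average_near_of_partial_isometry hq hq' hp hqq (by abel) hqM' hvM hfv hv hve hb
      (norm_nonneg b) hb1 hb2
  · obtain ⟨u, hu, t', h⟩ := exists_average_near_of_partial_isometry (v := star v) (b := -b)
      hq' hq hp hqq' (by abel) hqM (star_mem hvM)
      (by have := congrArg star hve; rwa [star_mul, hq'.isSelfAdjoint.star_eq] at this)
      (by rw [star_star, hv])
      (by have := congrArg star hfv; rwa [star_mul, hq.isSelfAdjoint.star_eq] at this) hb.neg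
      (norm_nonneg b) (neg_le_of_neg_le hb2) (neg_le_neg hb1)
    refine ⟨u, hu, -t', ?_⟩
    rw [← norm_neg]
    have h3 : -((1 / 2 : ℝ) • (b + u * b * star u) - (-t') • p) =
        (1 / 2 : ℝ) • (-b + u * -b * star u) - t' • p := by
      rw [mul_neg, neg_mul]; module
    rw [h3]; exact h

theorem continuous_add_star_sub_wot (p : H →L[ℂ] H) :
    Continuous fun z : (H →WOT[ℂ] H) × ℝ =>
      (ofCLM (z.1.toCLM + star z.1.toCLM - z.2 • p) : H →WOT[ℂ] H) := by
  have : Continuous fun z : (H →WOT[ℂ] H) × ℝ => z.1 + star z.1 - z.2 • (ofCLM p : H →WOT[ℂ] H) := by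
    fun_prop
  exact this

/-- In a corner of a factor, the real part of any element averages to a scalar: at a point of the
weakly compact set of averages whose real part is closest to the scalars, the averaging step
forces this distance to vanish. -/
theorem IsFactor.exists_add_star_eq {M : VonNeumannAlgebra H} (hM : M.IsFactor)
    {p x : H →L[ℂ] H} (hpM : p ∈ M) (hp : IsStarProjection p) (hxM : x ∈ M)
    (hpx : x = p * x * p) : ∃ y ∈ M.averages p x, ∃ t : ℝ, y + star y = t • p := by
  by_cases hp0 : p = 0
  · refine ⟨x, self_mem_averages, 0, ?_⟩
    rw [hpx, hp0]; simp
  -- Beyond `B` the distance to `t p` exceeds its value at `t = 0`.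
  let B : ℝ := 4 * ‖x‖ / ‖p‖
  let F : Set ((H →WOT[ℂ] H) × ℝ) := (toCLM ⁻¹' M.averages p x) ×ˢ Set.Icc (-B) B
  have hB : 0 ≤ B := by positivity
  have hF : IsCompact F := (isWOTClosed_averages.isCompact
    fun y hy => norm_le_of_mem_averages hy).prod isCompact_Icc
  have hlsc : LowerSemicontinuous fun z : (H →WOT[ℂ] H) × ℝ =>
      ‖z.1.toCLM + star z.1.toCLM - z.2 • p‖ := by
    rw [lowerSemicontinuous_iff_isClosed_preimage]
    intro C
    exact IsClosed.preimage (continuous_add_star_sub_wot p) (isWOTClosed_closedBall C)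
  have hx0 : ((ofCLM x : H →WOT[ℂ] H), (0 : ℝ)) ∈ F :=
    ⟨self_mem_averages, by simpa using hB⟩
  obtain ⟨⟨y, t⟩, ⟨hy, ht⟩, hmin⟩ := LowerSemicontinuousOn.exists_isMinOn ⟨_, hx0⟩ hF
    (hlsc.lowerSemicontinuousOn F)
  obtain ⟨y, rfl⟩ := ofCLM_surjective y
  change y ∈ M.averages p x at hy
  have hmin' : ∀ z ∈ M.averages p x, ∀ r ∈ Set.Icc (-B) B,
      ‖y + star y - t • p‖ ≤ ‖z + star z - r • p‖ := fun z hz r hr =>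
    isMinOn_iff.1 hmin (ofCLM z, r) ⟨hz, hr⟩
  clear hmin
  have hre : ∀ z ∈ M.averages p x, ‖z + star z‖ ≤ 2 * ‖x‖ := fun z hz => by
    refine (norm_add_le _ _).trans ?_
    rw [norm_star]; linarith [norm_le_of_mem_averages hz]
  have hs : ‖y + star y - t • p‖ ≤ 2 * ‖x‖ := by
    have := hmin' x self_mem_averages 0 hx0.2
    rw [zero_smul, sub_zero] at this
    exact this.trans (hre x self_mem_averages)
  have hyM : y ∈ M := averages_subset_coe le_rfl hxM hy
  obtain ⟨u, hu, t', h⟩ := hM.exists_average_near hpM hp (add_mem hyM (star_mem hyM))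
    (IsSelfAdjoint.add_star_self y) (by
      have h1 := corner_of_mem_averages hpx hy
      have h2 := congrArg star h1
      rw [star_mul, star_mul, hp.isSelfAdjoint.star_eq, ← mul_assoc] at h2
      rw [mul_add, add_mul, ← h1, ← h2]) t
  -- A second average whose real part is closer to the scalars unless the minimum is zero.
  let y' := (1 / 2 : ℝ) • y + (1 / 2 : ℝ) • (u * y * star u)
  have hy' : y' ∈ M.averages p x := convex_averages hy (conj_mem_averages hu hy)
    (by norm_num) (by norm_num) (by norm_num)
  have hy's : (1 / 2 : ℝ) • (y + star y + u * (y + star y) * star u) = y' + star y' := by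
    simp only [y', star_add, star_smul, star_mul, star_star, mul_add, add_mul, mul_assoc,
      star_trivial (1 / 2 : ℝ)]
    module
  rw [hy's] at h
  have ht' : t' ∈ Set.Icc (-B) B := by
    rw [Set.mem_Icc, ← abs_le, le_div_iff₀ (norm_pos_iff.2 hp0), ← Real.norm_eq_abs, ← norm_smul]
    have h1 : t' • p = (y' + star y') - (y' + star y' - t' • p) := by abel
    rw [h1]
    refine (norm_sub_le _ _).trans ?_
    linarith [hre y' hy', norm_nonneg x]
  have hle : ‖y + star y - t • p‖ ≤ ‖y' + star y' - t' • p‖ :=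
    hmin' y' hy' t' ht'
  have h0 : ‖y + star y - t • p‖ = 0 :=
    le_antisymm (by linarith) (norm_nonneg _)
  exact ⟨y, hy, t, sub_eq_zero.1 (norm_eq_zero.1 h0)⟩

/-- Averaging in a factor: for `p ∈ M` and `x ∈ p M p` the averages of `x` contain a scalar
multiple of `p`. -/
theorem IsFactor.exists_smul_mem_averages {M : VonNeumannAlgebra H} (hM : M.IsFactor)
    {p x : H →L[ℂ] H} (hpM : p ∈ M) (hp : IsStarProjection p) (hxM : x ∈ M)
    (hpx : x = p * x * p) : ∃ c : ℂ, c • p ∈ M.averages p x := by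
  obtain ⟨y, hy, t, hyt⟩ := hM.exists_add_star_eq hpM hp hxM hpx
  have hyM : y ∈ M := averages_subset_coe le_rfl hxM hy
  have hyp := corner_of_mem_averages hpx hy
  -- Averaging `-i y` makes the imaginary part scalar and leaves the real part `t p` untouched.
  obtain ⟨z, hz, t', hzt⟩ := hM.exists_add_star_eq (x := -Complex.I • y) hpM hp
    (M.smul_mem_coe _ hyM) (by rw [mul_smul_comm, smul_mul_assoc, ← hyp])
  have hw : Complex.I • z ∈ M.averages p y := by
    have := conj_add_mem_of_mem_weakClosedConvexHull (Complex.I • 1) 1 0 convex_averages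
      (isWOTClosed_averages (M := M) (p := p) (x := y)) ?_ hz
    · simpa using this
    · rintro _ ⟨u, hu, rfl⟩
      have : Complex.I • (1 : H →L[ℂ] H) * (u * (-Complex.I • y) * star u) * 1 + 0 =
          u * y * star u := by
        simp only [mul_smul_comm, smul_mul_assoc, one_mul, mul_one, add_zero, smul_smul]
        simp
      rw [this]; exact conj_mem_averages_self hu
  have hre : Complex.I • z + star (Complex.I • z) = t • p := by
    refine averages_subset (K := {w | w + star w = t • p}) ?_ ?_ ?_ hw
    · intro a ha b hb r s _ _ hrs
      simp only [Set.mem_ofPred_eq] at *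
      calc r • a + s • b + star (r • a + s • b) = r • (a + star a) + s • (b + star b) := by
            simp only [star_add, star_smul, star_trivial r, star_trivial s]; module
        _ = (r + s) • t • p := by rw [ha, hb, add_smul]
        _ = t • p := by rw [hrs, one_smul]
    · have h1 : Continuous fun w : H →WOT[ℂ] H => w + star w := by fun_prop
      exact isWOTClosed_setOf_eq h1 continuous_const
    · intro u hu
      have : u * y * star u + star (u * y * star u) = u * (y + star y) * star u := by
        simp only [star_mul, star_star, mul_add, add_mul, mul_assoc]
      rw [Set.mem_ofPred_eq, this, hyt, mul_smul_comm, smul_mul_assoc,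
        mem_reducingUnitaries_conj_self hu]
  refine ⟨(t / 2 : ℂ) + Complex.I * (t' / 2), ?_⟩
  have him : Complex.I • z - star (Complex.I • z) = Complex.I • (t' • p) := by
    rw [← hzt, star_smul, Complex.star_def, Complex.conj_I, smul_add, neg_smul, sub_neg_eq_add]
  have : ((t / 2 : ℂ) + Complex.I * (t' / 2)) • p = Complex.I • z := by
    have h1 : Complex.I • z = (1 / 2 : ℂ) • ((Complex.I • z + star (Complex.I • z)) +
        (Complex.I • z - star (Complex.I • z))) := by module
    have hc : ∀ r : ℝ, r • p = (r : ℂ) • p := fun r => by ext; simp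
    rw [h1, hre, him, hc, hc]
    module
  rw [this]
  exact averages_subset_of_mem hy hw

/-! ### Fixed points of amenable groups of unitaries -/

/-- A single conjugation has a fixed point in an invariant set: Cesàro means of an orbit are almost
fixed, hence accumulate at fixed points. -/
theorem exists_conj_fixed {K : Set (H →L[ℂ] H)} (hK : Convex ℝ K) (hc : IsWOTClosed K) {C : ℝ}
    (hC : ∀ x ∈ K, ‖x‖ ≤ C) (hne : K.Nonempty) {u : H →L[ℂ] H}
    (hu : ∀ y ∈ K, u * y * star u ∈ K) : ∃ y ∈ K, u * y * star u = y := by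
  obtain ⟨x, hx⟩ := hne
  have hC0 : 0 ≤ C := (norm_nonneg x).trans (hC x hx)
  let z : ℕ → H →L[ℂ] H := fun k => (fun y => u * y * star u)^[k] x
  have hz : ∀ k, z k ∈ K := fun k => by
    induction k with
    | zero => exact hx
    | succ k ih =>
      simp only [z, Function.iterate_succ_apply']
      exact hu _ ih
  have hz' : ∀ k, u * z k * star u = z (k + 1) := fun k => by
    simp only [z, Function.iterate_succ_apply']
  let S : ℕ → Set (H →L[ℂ] H) := fun n =>
    K ∩ {y | ‖u * y * star u - y‖ ≤ 2 * C / (n + 1)}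
  have hS : ∀ n, (S n).Nonempty := fun n => by
    refine ⟨∑ k ∈ Finset.range (n + 1), (1 / (n + 1) : ℝ) • z k, ?_, ?_⟩
    · refine hK.sum_mem (fun _ _ => by positivity) ?_ fun k _ => hz k
      rw [Finset.sum_const, Finset.card_range, nsmul_eq_mul]
      push_cast
      field_simp
    · have h1 : u * (∑ k ∈ Finset.range (n + 1), (1 / (n + 1) : ℝ) • z k) * star u -
          ∑ k ∈ Finset.range (n + 1), (1 / (n + 1) : ℝ) • z k =
          (1 / (n + 1) : ℝ) • (z (n + 1) - z 0) := by
        rw [Finset.mul_sum, Finset.sum_mul, ← Finset.sum_sub_distrib, ← Finset.sum_range_sub,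
          Finset.smul_sum]
        refine Finset.sum_congr rfl fun k _ => ?_
        rw [mul_smul_comm, smul_mul_assoc, hz', smul_sub]
      rw [Set.mem_ofPred_eq, h1, norm_smul, Real.norm_of_nonneg (by positivity)]
      rw [div_mul_eq_mul_div, one_mul]
      gcongr
      refine (norm_sub_le _ _).trans ?_
      linarith [hC _ (hz (n + 1)), hC _ (hz 0)]
  have hcont : Continuous fun y : H →WOT[ℂ] H =>
      (ofCLM (u * y.toCLM * star u - y.toCLM) : H →WOT[ℂ] H) := by
    have := (continuous_conj_add_wot u (star u) 0).sub (continuous_id (X := H →WOT[ℂ] H))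
    refine this.congr fun y => ?_
    simp
  obtain ⟨y, hy⟩ := exists_mem_forall_of_antitone (S := S) (C := C)
    (fun m n hmn y hy => ⟨hy.1, le_trans hy.2
      (show 2 * C / ((n : ℝ) + 1) ≤ 2 * C / ((m : ℝ) + 1) by gcongr)⟩) hS
    (fun n => hc.inter (isWOTClosed_setOf_norm_le _ hcont)) (fun y hy => hC y hy.1)
  refine ⟨y, (hy 0).1, ?_⟩
  have h0 : ‖u * y * star u - y‖ ≤ 0 := by
    refine ge_of_tendsto' (x := atTop) (f := fun n : ℕ => 2 * C / ((n : ℝ) + 1)) ?_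
      fun n => (hy n).2
    have := (tendsto_one_div_add_atTop_nhds_zero_nat (𝕜 := ℝ)).const_mul (2 * C)
    simpa [div_eq_mul_inv] using this
  exact sub_eq_zero.1 (norm_le_zero_iff.1 h0)

/-- The Markov–Kakutani fixed point theorem for conjugation by commuting operators. -/
theorem exists_forall_conj_fixed {K : Set (H →L[ℂ] H)} (hK : Convex ℝ K) (hc : IsWOTClosed K)
    {C : ℝ} (hC : ∀ x ∈ K, ‖x‖ ≤ C) (hne : K.Nonempty) {G : Set (H →L[ℂ] H)}
    (hG : ∀ u ∈ G, ∀ y ∈ K, u * y * star u ∈ K) (hcomm : ∀ u ∈ G, ∀ v ∈ G, u * v = v * u) :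
    ∃ y ∈ K, ∀ u ∈ G, u * y * star u = y := by
  have hfix : ∀ u : H →L[ℂ] H, IsWOTClosed {y : H →L[ℂ] H | u * y * star u = y} := fun u => by
    simpa using isWOTClosed_setOf_conj_eq u (star u) 1 1
  have hfixc : ∀ u : H →L[ℂ] H, Convex ℝ {y : H →L[ℂ] H | u * y * star u = y} := fun u => by
    simpa using convex_setOf_conj_eq u (star u) 1 1
  have hfin : ∀ s : Finset G, ∃ y ∈ K, ∀ u ∈ s, (u : H →L[ℂ] H) * y * star (u : H →L[ℂ] H) = y := by
    intro s
    classical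
    have hcl : IsWOTClosed (K ∩ ⋂ u ∈ s, {y | (u : H →L[ℂ] H) * y * star (u : H →L[ℂ] H) = y}) := by
      refine hc.inter ?_
      simp only [IsWOTClosed, Set.preimage_iInter]
      exact isClosed_biInter fun u _ => hfix u
    induction s using Finset.induction_on with
    | empty => exact hne.imp fun y hy => ⟨hy, by simp⟩
    | insert v s _ ih =>
      have hcl' : IsWOTClosed
          (K ∩ ⋂ u ∈ s, {y | (u : H →L[ℂ] H) * y * star (u : H →L[ℂ] H) = y}) := by
        refine hc.inter ?_
        simp only [IsWOTClosed, Set.preimage_iInter]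
        exact isClosed_biInter fun u _ => hfix u
      obtain ⟨y, hy, hys⟩ := ih hcl'
      obtain ⟨w, ⟨hwK, hws⟩, hwv⟩ := exists_conj_fixed
        (hK.inter (convex_iInter₂ fun (u : G) (_ : u ∈ s) => hfixc u)) hcl' (C := C)
        (fun x hx => hC x hx.1) ⟨y, hy, Set.mem_iInter₂.2 hys⟩ (u := v) (by
          rintro w ⟨hwK, hws⟩
          refine ⟨hG v v.2 w hwK, Set.mem_iInter₂.2 fun u hu => ?_⟩
          have h1 : (u : H →L[ℂ] H) * w * star (u : H →L[ℂ] H) = w := Set.mem_iInter₂.1 hws u hu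
          have h2 := hcomm u u.2 v v.2
          have h3 := congrArg star h2
          rw [star_mul, star_mul] at h3
          calc (u : H →L[ℂ] H) * (v * w * star (v : H →L[ℂ] H)) * star (u : H →L[ℂ] H)
              = (u * v) * w * (star (v : H →L[ℂ] H) * star (u : H →L[ℂ] H)) := by
                simp only [mul_assoc]
            _ = v * (u * w * star (u : H →L[ℂ] H)) * star (v : H →L[ℂ] H) := by
                rw [h2, h3]; simp only [mul_assoc]
            _ = _ := by rw [h1])
      refine ⟨w, hwK, fun u hu => ?_⟩
      rcases Finset.mem_insert.1 hu with rfl | hu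
      · exact hwv
      · exact Set.mem_iInter₂.1 hws u hu
  obtain ⟨y, hyK, hy⟩ := (hc.isCompact hC).inter_iInter_nonempty
    (fun u : G => toCLM ⁻¹' {y | (u : H →L[ℂ] H) * y * star (u : H →L[ℂ] H) = y})
    (fun u => hfix u) fun s => by
      obtain ⟨y, hy, hys⟩ := hfin s
      exact ⟨ofCLM y, hy, Set.mem_iInter₂.2 hys⟩
  exact ⟨y.toCLM, hyK, fun u hu => Set.mem_iInter.1 hy ⟨u, hu⟩⟩

/-- A compact group acting linearly on a Banach space fixes a point of every nonempty closed convex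
invariant set: integrate an orbit against Haar measure. -/
theorem exists_fixed_of_compactGroup {G E : Type*} [Group G] [TopologicalSpace G]
    [IsTopologicalGroup G] [CompactSpace G] [T2Space G] [NormedAddCommGroup E] [NormedSpace ℝ E]
    [CompleteSpace E] (π : G → E →L[ℝ] E) (hmul : ∀ g h x, π (g * h) x = π g (π h x))
    (hcont : ∀ x, Continuous fun g => π g x) {K : Set E} (hK : Convex ℝ K) (hc : IsClosed K)
    (hne : K.Nonempty) (hG : ∀ g, ∀ x ∈ K, π g x ∈ K) : ∃ y ∈ K, ∀ g, π g y = y := by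
  obtain ⟨x, hx⟩ := hne
  let _ : MeasurableSpace G := borel G
  have : BorelSpace G := ⟨rfl⟩
  let K₀ : TopologicalSpace.PositiveCompacts G := ⊤
  let μ := MeasureTheory.Measure.haarMeasure K₀
  have : MeasureTheory.IsProbabilityMeasure μ :=
    ⟨by simpa [K₀] using MeasureTheory.Measure.haarMeasure_self (K₀ := K₀)⟩
  have hint : MeasureTheory.Integrable (fun g => π g x) μ := by
    have := (hcont x).continuousOn.integrableOn_compact (μ := μ) (isCompact_univ (X := G))
    simpa using! this
  refine ⟨∫ g, π g x ∂μ, hK.integral_mem hc (Eventually.of_forall fun g => hG g x hx) hint,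
    fun h => ?_⟩
  rw [← (π h).integral_comp_comm hint]
  simp_rw [← hmul]
  exact MeasureTheory.integral_mul_left_eq_self (fun g => π g x) h

theorem compactSpace_unitary (B : StarSubalgebra ℂ (H →L[ℂ] H)) [FiniteDimensional ℂ B] :
    CompactSpace (unitary B) := by
  have : ProperSpace B := FiniteDimensional.proper ℂ B
  refine isCompact_iff_compactSpace.1 ?_
  refine Metric.isCompact_of_isClosed_isBounded isClosed_unitary ?_
  refine (Metric.isBounded_closedBall (x := (0 : B)) (r := 1)).subset fun u hu => ?_
  rw [mem_closedBall_zero_iff]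
  have h1 : star (u : H →L[ℂ] H) * u = 1 := congrArg Subtype.val (Unitary.star_mul_self_of_mem hu)
  change ‖(u : H →L[ℂ] H)‖ ≤ 1
  exact (norm_le_one_iff_star_mul_le _).2 h1.le

/-- Operators commuting with the unitaries of a closed *-algebra commute with the algebra. -/
theorem commute_of_forall_unitary {B : StarSubalgebra ℂ (H →L[ℂ] H)}
    (hB : IsClosed (B : Set (H →L[ℂ] H))) {y : H →L[ℂ] H}
    (h : ∀ u ∈ B, star u * u = 1 → u * star u = 1 → u * y = y * u) {b : H →L[ℂ] H} (hb : b ∈ B) :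
    b * y = y * b := by
  -- `hB` is the instance argument that makes `B` a C⋆-algebra, spanned by its unitaries.
  have := hB
  have hspan : (⟨b, hb⟩ : B) ∈ Submodule.span ℂ (unitary B : Set B) := by
    rw [CStarAlgebra.span_unitary]; trivial
  have : ∀ a ∈ Submodule.span ℂ (unitary B : Set B), (a : H →L[ℂ] H) * y = y * a := by
    intro a ha
    induction ha using Submodule.span_induction with
    | mem u hu =>
      exact h u u.2 (congrArg Subtype.val (Unitary.star_mul_self_of_mem hu))
        (congrArg Subtype.val (Unitary.mul_star_self_of_mem hu))
    | zero => simp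
    | add a b _ _ ha hb => simp [add_mul, mul_add, ha, hb]
    | smul c a _ ha => simp [ha]
  exact this _ hspan

theorem isClosed_of_finiteDimensional (B : StarSubalgebra ℂ (H →L[ℂ] H)) [FiniteDimensional ℂ B] :
    IsClosed (B : Set (H →L[ℂ] H)) :=
  have : FiniteDimensional ℂ (Subalgebra.toSubmodule B.toSubalgebra) :=
    inferInstanceAs (FiniteDimensional ℂ B)
  Submodule.closed_of_finiteDimensional (Subalgebra.toSubmodule B.toSubalgebra)

theorem commute_of_conj_eq {u y : H →L[ℂ] H} (hu : star u * u = 1) (h : u * y * star u = y) :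
    u * y = y * u := by
  calc u * y = u * y * (star u * u) := by rw [hu, mul_one]
    _ = y * u := by rw [← mul_assoc, h]

/-- Simultaneous averaging of a pair of operators over the unitary group of a finite-dimensional
*-algebra. -/
theorem exists_pair_commute_of_finiteDimensional (B : StarSubalgebra ℂ (H →L[ℂ] H))
    [FiniteDimensional ℂ B] {K : Set ((H →L[ℂ] H) × (H →L[ℂ] H))} (hK : Convex ℝ K)
    (hc : IsClosed K) (hne : K.Nonempty)
    (hB : ∀ u ∈ B, star u * u = 1 → u * star u = 1 →
      ∀ z ∈ K, (u * z.1 * star u, u * z.2 * star u) ∈ K) :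
    ∃ z ∈ K, ∀ b ∈ B, b * z.1 = z.1 * b ∧ b * z.2 = z.2 * b := by
  have := compactSpace_unitary B
  let val : unitary B → (H →L[ℂ] H) := fun u => ((u : B) : H →L[ℂ] H)
  have hval : Continuous val := by fun_prop
  let π₁ : unitary B → (H →L[ℂ] H) →L[ℝ] (H →L[ℂ] H) := fun u =>
    (((ContinuousLinearMap.mul ℝ (H →L[ℂ] H)).flip (star (val u))).comp
      (ContinuousLinearMap.mul ℝ (H →L[ℂ] H) (val u)))
  have hπ₁ : ∀ u x, π₁ u x = val u * x * star (val u) := fun u x => rfl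
  have hu1 : ∀ u : unitary B, star (val u) * val u = 1 := fun u =>
    congrArg Subtype.val (Unitary.star_mul_self_of_mem u.2)
  have hu2 : ∀ u : unitary B, val u * star (val u) = 1 := fun u =>
    congrArg Subtype.val (Unitary.mul_star_self_of_mem u.2)
  obtain ⟨z, hz, hfix⟩ := exists_fixed_of_compactGroup (G := unitary B)
    (fun u => (π₁ u).prodMap (π₁ u)) (fun g h x => by
      have hgh : val (g * h) = val g * val h := rfl
      refine Prod.ext ?_ ?_ <;>
      · simp only [ContinuousLinearMap.coe_prodMap', Prod.map_fst, Prod.map_snd, hπ₁, hgh, star_mul,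
          mul_assoc])
    (fun x => by
      simp only [ContinuousLinearMap.coe_prodMap', Prod.map_def, hπ₁]
      fun_prop) hK hc hne
    (fun u z hz => hB (val u) (u : B).2 (hu1 u) (hu2 u) z hz)
  have key : ∀ u ∈ B, star u * u = 1 → u * star u = 1 → u * z.1 = z.1 * u ∧ u * z.2 = z.2 * u := by
    intro u hu h1 h2
    have h := hfix ⟨⟨u, hu⟩, by
      rw [Unitary.mem_iff]; exact ⟨Subtype.ext h1, Subtype.ext h2⟩⟩
    exact ⟨commute_of_conj_eq h1 (congrArg Prod.fst h), commute_of_conj_eq h1 (congrArg Prod.snd h)⟩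
  have hcl := isClosed_of_finiteDimensional B
  exact ⟨z, hz, fun b hb =>
    ⟨commute_of_forall_unitary hcl (fun u hu h1 h2 => (key u hu h1 h2).1) hb,
      commute_of_forall_unitary hcl (fun u hu h1 h2 => (key u hu h1 h2).2) hb⟩⟩

theorem exists_commute_of_finiteDimensional (B : StarSubalgebra ℂ (H →L[ℂ] H))
    [FiniteDimensional ℂ B] {K : Set (H →L[ℂ] H)} (hK : Convex ℝ K)
    (hc : IsClosed K) (hne : K.Nonempty)
    (hB : ∀ u ∈ B, star u * u = 1 → u * star u = 1 → ∀ y ∈ K, u * y * star u ∈ K) :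
    ∃ y ∈ K, ∀ b ∈ B, b * y = y * b := by
  obtain ⟨z, hz, h⟩ := exists_pair_commute_of_finiteDimensional B (hK.prod (convex_singleton 0))
    (hc.prod isClosed_singleton) (hne.prod (Set.singleton_nonempty 0))
    (fun u hu h1 h2 z hz => ⟨hB u hu h1 h2 z.1 hz.1, by
      have h0 : z.2 = 0 := hz.2
      simp [h0]⟩)
  exact ⟨z.1, hz.1, fun b hb => (h b hb).1⟩

/-! ### The trace -/

/-- A faithful tracial state on `M`, given by a linear functional on all bounded operators that is
weak operator continuous on bounded sets. -/
structure IsTraceFunctional (M : VonNeumannAlgebra H) (Φ : (H →L[ℂ] H) →ₗ[ℂ] ℂ) : Prop where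
  map_one : Φ 1 = 1
  nonneg : ∀ x ∈ M, 0 ≤ (Φ (star x * x)).re ∧ (Φ (star x * x)).im = 0
  faithful : ∀ x ∈ M, Φ (star x * x) = 0 → x = 0
  tracial : ∀ x ∈ M, ∀ y ∈ M, Φ (x * y) = Φ (y * x)
  continuousOn : ∀ C : ℝ, ContinuousOn (fun x : H →WOT[ℂ] H => Φ x.toCLM)
    (toCLM ⁻¹' {x | ‖x‖ ≤ C})

/-- A normal trace extends to all bounded operators by its vector series, which converges uniformly
on bounded sets. -/
theorem IsNormalTracialState.exists_isTraceFunctional {M : VonNeumannAlgebra H}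
    {τ : M.toStarSubalgebra →ₗ[ℂ] ℂ} (hτ : M.IsNormalTracialState τ) :
    ∃ Φ, M.IsTraceFunctional Φ := by
  obtain ⟨ξ, η, hξ, hη, hsum⟩ := hτ.normal
  have hs : Summable fun n => (‖ξ n‖ ^ 2 + ‖η n‖ ^ 2) / 2 := (hξ.add hη).div_const 2
  have hb : ∀ (n : ℕ) (x : H →L[ℂ] H),
      ‖inner ℂ (ξ n) (x (η n))‖ ≤ ‖x‖ * ((‖ξ n‖ ^ 2 + ‖η n‖ ^ 2) / 2) := fun n x => by
    calc ‖inner ℂ (ξ n) (x (η n))‖ ≤ ‖ξ n‖ * (‖x‖ * ‖η n‖) :=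
          (norm_inner_le_norm _ _).trans (by gcongr; exact x.le_opNorm _)
      _ = ‖x‖ * (‖ξ n‖ * ‖η n‖) := by ring
      _ ≤ _ := by gcongr; nlinarith [sq_nonneg (‖ξ n‖ - ‖η n‖)]
  have hsm : ∀ x : H →L[ℂ] H, Summable fun n => inner ℂ (ξ n) (x (η n)) := fun x =>
    Summable.of_norm_bounded (hs.mul_left ‖x‖) fun n => hb n x
  let Φ : (H →L[ℂ] H) →ₗ[ℂ] ℂ :=
    { toFun := fun x => ∑' n, inner ℂ (ξ n) (x (η n))
      map_add' := fun x y => by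
        rw [← (hsm x).tsum_add (hsm y)]
        simp only [_root_.add_apply, inner_add_right]
      map_smul' := fun c x => by
        simp only [_root_.smul_apply, inner_smul_right, RingHom.id_apply, smul_eq_mul,
          tsum_mul_left] }
  have hΦ : ∀ x : M.toStarSubalgebra, Φ x = τ x := fun x => (hsum x).tsum_eq
  refine ⟨Φ, ?_, ?_, ?_, ?_, ?_⟩
  · exact (hΦ 1).trans hτ.map_one
  · intro x hx
    have := hΦ (star ⟨x, hx⟩ * ⟨x, hx⟩)
    have h := hτ.nonneg ⟨x, hx⟩
    rw [← this] at h
    exact h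
  · intro x hx h0
    have := hτ.faithful ⟨x, hx⟩ (by rw [← hΦ]; exact h0)
    exact congrArg Subtype.val this
  · intro x hx y hy
    have := hτ.tracial ⟨x, hx⟩ ⟨y, hy⟩
    rw [← hΦ, ← hΦ] at this
    exact this
  · intro C
    refine continuousOn_tsum (u := fun n => C * ((‖ξ n‖ ^ 2 + ‖η n‖ ^ 2) / 2)) (fun n => ?_)
      (hs.mul_left C) fun n x hx => ?_
    · exact ((continuous_iff.1 (continuous_id (X := H →WOT[ℂ] H))) (η n) (ξ n)).continuousOn
    · refine (hb n x.toCLM).trans ?_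
      have : ‖x.toCLM‖ ≤ C := hx
      gcongr

theorem IsTypeII1Factor.exists_isTraceFunctional {M : VonNeumannAlgebra H}
    (hM : M.IsTypeII1Factor) : ∃ Φ, M.IsTraceFunctional Φ :=
  let ⟨_, hτ⟩ := hM.2.2
  hτ.exists_isTraceFunctional

namespace IsTraceFunctional

variable {M : VonNeumannAlgebra H} {Φ : (H →L[ℂ] H) →ₗ[ℂ] ℂ}

theorem re_nonneg (hΦ : M.IsTraceFunctional Φ) {p : H →L[ℂ] H} (hpM : p ∈ M)
    (hp : IsStarProjection p) : 0 ≤ (Φ p).re := by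
  have := (hΦ.nonneg p hpM).1
  rwa [hp.isSelfAdjoint.star_eq, hp.isIdempotentElem.eq] at this

theorem eq_zero_of_projection (hΦ : M.IsTraceFunctional Φ) {p : H →L[ℂ] H} (hpM : p ∈ M)
    (hp : IsStarProjection p) (h : Φ p = 0) : p = 0 :=
  hΦ.faithful p hpM (by rwa [hp.isSelfAdjoint.star_eq, hp.isIdempotentElem.eq])

theorem re_pos (hΦ : M.IsTraceFunctional Φ) {p : H →L[ℂ] H} (hpM : p ∈ M)
    (hp : IsStarProjection p) (h : p ≠ 0) : 0 < (Φ p).re := by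
  refine (hΦ.re_nonneg hpM hp).lt_of_ne fun h0 => h (hΦ.eq_zero_of_projection hpM hp ?_)
  have := (hΦ.nonneg p hpM).2
  rw [hp.isSelfAdjoint.star_eq, hp.isIdempotentElem.eq] at this
  exact Complex.ext h0.symm this

theorem isWOTClosed_setOf_eq (hΦ : M.IsTraceFunctional Φ) (C : ℝ) (c : ℂ) :
    IsWOTClosed {x : H →L[ℂ] H | ‖x‖ ≤ C ∧ Φ x = c} :=
  (hΦ.continuousOn C).preimage_isClosed_of_isClosed (isWOTClosed_closedBall C) isClosed_singleton

end IsTraceFunctional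

/-! ### Subalgebras along which averaging is possible -/

/-- A *-subalgebra `C` of `M` that is rich enough for averaging elements of `N`: corners at
projections of `C` are mean-value ergodic, atoms of `C` are atoms of `N`, and `C` contains spectral
projections of its self-adjoint elements. -/
structure IsAveragingSubalgebra (M N : VonNeumannAlgebra H) (C : StarSubalgebra ℂ (H →L[ℂ] H)) :
    Prop where
  le : ∀ c ∈ C, c ∈ M
  isMVErgodicAt : ∀ p ∈ C, IsStarProjection p → M.IsMVErgodicAt N p
  corner_eq : ∀ e ∈ C, IsStarProjection e → (∀ c ∈ C, ∃ l : ℂ, e * c * e = l • e) →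
    ∀ x ∈ N, ∃ l : ℂ, e * x * e = l • e
  spectral : ∀ c ∈ C, IsSelfAdjoint c → ∃ r ∈ C, IsStarProjection r ∧
    (∀ z, z * c = c * z → z * r = r * z) ∧ 0 ≤ c * r ∧ c * (1 - r) ≤ 0

/-- An abelian *-subalgebra that is maximal abelian in `N` is an averaging subalgebra: the
Markov–Kakutani theorem moves averages into the relative commutant of `A`, which lies in `M`. -/
theorem isAveragingSubalgebra_of_masa {M N : VonNeumannAlgebra H} (hM : M.IsFactor) (hMN : M ≤ N)
    {A : StarSubalgebra ℂ (H →L[ℂ] H)} (hA : ∀ a ∈ A, ∀ b ∈ A, a * b = b * a)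
    (hAM : (A : Set (H →L[ℂ] H)) ⊆ M)
    (hmax : Set.centralizer (A : Set (H →L[ℂ] H)) ∩ N = (A : Set (H →L[ℂ] H))) :
    M.IsAveragingSubalgebra N A := by
  have hcl : IsClosed (A : Set (H →L[ℂ] H)) := by
    rw [← hmax]
    exact ((isWOTClosed_centralizer _).inter N.isWOTClosed_coe).isClosed
  have hmem : ∀ y ∈ N, (∀ a ∈ A, a * y = y * a) → y ∈ A := fun y hy h => by
    rw [← SetLike.mem_coe, ← hmax]
    exact ⟨fun a ha => h a ha, hy⟩
  refine ⟨fun c hc => hAM hc, fun p hpA hp x hx hpx => ?_, fun e he hep hmin x hx => ?_,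
    fun c hc hcs => ?_⟩
  · obtain ⟨y, hy, hfix⟩ := exists_forall_conj_fixed (K := M.averages p x) convex_averages
      isWOTClosed_averages (fun y hy => norm_le_of_mem_averages hy) ⟨x, self_mem_averages⟩
      (G := {u | u ∈ A ∧ star u * u = 1 ∧ u * star u = 1})
      (fun u hu y hy => conj_mem_averages ⟨hAM hu.1, hu.2, hA u hu.1 p hpA⟩ hy)
      (fun u hu v hv => hA u hu.1 v hv.1)
    have hyA : y ∈ A := hmem y (averages_subset_coe hMN hx hy) fun a ha =>
      commute_of_forall_unitary hcl
        (fun u hu h1 h2 => commute_of_conj_eq h1 (hfix u ⟨hu, h1, h2⟩)) ha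
    obtain ⟨c, hc⟩ := hM.exists_smul_mem_averages (hAM hpA) hp (hAM hyA)
      (corner_of_mem_averages hpx hy)
    exact ⟨c, averages_subset_of_mem hy hc⟩
  · have hee : e * e = e := hep.isIdempotentElem
    have heN : e ∈ N := hMN (hAM he)
    obtain ⟨l, hl⟩ := hmin (e * x * e) (hmem _ (mul_mem (mul_mem heN hx) heN) fun a ha => by
      obtain ⟨l, hl⟩ := hmin a ha
      have h1 : a * e = l • e := by rw [← hl, hA e he a ha, mul_assoc, hee]
      have h2 : e * a = l • e := by rw [hA e he a ha, h1]
      rw [← mul_assoc, ← mul_assoc, h1, mul_assoc _ e a, h2]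
      simp only [smul_mul_assoc, mul_smul_comm])
    refine ⟨l, ?_⟩
    rw [← hl, mul_assoc, mul_assoc, mul_assoc, mul_assoc, hee, ← mul_assoc e e, hee]
  · obtain ⟨r, hr, hrc, h1, h2⟩ := exists_spectral_projection hcs
    refine ⟨r, hmem r ?_ fun a ha => hrc a (hA a ha c hc), hr, hrc, h1, h2⟩
    exact mem_of_forall_commute fun z hz =>
      hrc z (mem_commutant_iff.1 hz c (hMN (hAM hc))).symm

theorem finite_spectrum_of_mem (B : StarSubalgebra ℂ (H →L[ℂ] H)) [FiniteDimensional ℂ B]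
    {c : H →L[ℂ] H} (hc : c ∈ B) : (spectrum ℝ c).Finite := by
  have hint : IsIntegral ℂ (⟨c, hc⟩ : B) := IsIntegral.of_finite ℂ _
  obtain ⟨P, hP, hPc⟩ := hint
  have hPc' : Polynomial.aeval c P = 0 := by
    have h1 : Polynomial.aeval (⟨c, hc⟩ : B) P = 0 := hPc
    have h2 := congrArg B.subtype h1
    rw [← Polynomial.aeval_algHom_apply] at h2
    simpa using! h2
  have hfin : (spectrum ℂ c).Finite := by
    refine (P.roots.toFinset.finite_toSet).subset fun l hl => ?_
    rw [Finset.mem_coe, Multiset.mem_toFinset, Polynomial.mem_roots hP.ne_zero]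
    have h := spectrum.subset_polynomial_aeval c P ⟨l, hl, rfl⟩
    rw [hPc'] at h
    by_cases hH : Nontrivial (H →L[ℂ] H)
    · rw [spectrum.zero_eq] at h
      exact h
    · rw [not_nontrivial_iff_subsingleton] at hH
      rw [spectrum.of_subsingleton] at h
      exact h.elim
  rw [← spectrum.preimage_algebraMap ℂ]
  exact hfin.preimage (algebraMap ℝ ℂ).injective.injOn

/-- In a finite-dimensional *-algebra spectra are finite, so that spectral projections come from
the continuous functional calculus. -/
theorem exists_spectral_projection_of_finiteDimensional (B : StarSubalgebra ℂ (H →L[ℂ] H))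
    [FiniteDimensional ℂ B] {c : H →L[ℂ] H} (hc : c ∈ B) (hcs : IsSelfAdjoint c) :
    ∃ r ∈ B, IsStarProjection r ∧ (∀ z, z * c = c * z → z * r = r * z) ∧
      0 ≤ c * r ∧ c * (1 - r) ≤ 0 := by
  have hfin := finite_spectrum_of_mem B hc
  let χ : ℝ → ℝ := fun t => if 0 ≤ t then 1 else 0
  have hcont : ∀ f : ℝ → ℝ, ContinuousOn f (spectrum ℝ c) := fun f => hfin.continuousOn f
  have hcr : c * cfc χ c = cfc (fun t => t * χ t) c := by
    rw [cfc_mul _ _ c (hcont _) (hcont _), cfc_id' ℝ c]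
  refine ⟨cfc χ c, ?_, ⟨?_, cfc_predicate _ _⟩, fun z hz => ?_, ?_, ?_⟩
  · have := isClosed_of_finiteDimensional B
    exact cfc_mem (𝕜' := ℂ) χ hc
  · rw [IsIdempotentElem, ← cfc_mul _ _ c (hcont _) (hcont _)]
    congr 1
    ext t
    simp only [χ]; split_ifs <;> simp
  · exact (Commute.cfc_real (show Commute c z from hz.symm) χ).symm.eq
  · rw [hcr]
    refine cfc_nonneg fun t _ => ?_
    simp only [χ]; split_ifs with h <;> simp [h]
  · have h1 : c * (1 - cfc χ c) = cfc (fun t => t - t * χ t) c := by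
      rw [cfc_sub _ _ c (hcont _) (hcont _), cfc_id' ℝ c, ← hcr, mul_sub, mul_one]
    rw [h1]
    refine cfc_nonpos _ _ fun t _ => ?_
    simp only [χ]
    split_ifs with h
    · simp
    · simp only [mul_zero, sub_zero]; exact (not_le.1 h).le

/-- Let `R` be ergodic in `N` and generated by the increasing finite-dimensional algebras `B m`.
Then an element of `p N p` commuting with all `p (B m) p` is a multiple of `p`: averages of the pair
`(y, p)` over the unitaries of `B m` keep the relation `p Y p = y (p P p)` and accumulate at a pair
of scalars `(Y, P)`, where `P` has the nonzero trace of `p`. -/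
theorem exists_eq_smul_of_commute_corner {R N : VonNeumannAlgebra H} (hRN : R ≤ N)
    (herg : R.IsErgodic N) {B : ℕ → StarSubalgebra ℂ (H →L[ℂ] H)} (hmono : Monotone B)
    (hfd : ∀ n, FiniteDimensional ℂ (B n))
    (hgen : Set.centralizer (Set.centralizer (⋃ n, (B n : Set (H →L[ℂ] H)))) = R)
    {Φ : (H →L[ℂ] H) →ₗ[ℂ] ℂ} (hΦ : R.IsTraceFunctional Φ) {p y : H →L[ℂ] H} (hpR : p ∈ R)
    (hp : IsStarProjection p) (hp0 : p ≠ 0) (hyN : y ∈ N) (hpy : y = p * y * p)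
    (hcomm : ∀ m, ∀ b ∈ B m, y * (p * b * p) = p * b * p * y) : ∃ c : ℂ, y = c • p := by
  have hpp : p * p = p := hp.isIdempotentElem
  have hyp : y * p = y := by
    conv_lhs => rw [hpy]
    rw [mul_assoc, hpp, ← hpy]
  have hBR : ∀ m, ∀ b ∈ B m, b ∈ R := fun m b hb => by
    rw [← SetLike.mem_coe, ← hgen]
    exact Set.subset_centralizer_centralizer (Set.mem_iUnion.2 ⟨m, hb⟩)
  let wp : (H →WOT[ℂ] H) × (H →WOT[ℂ] H) → (H →L[ℂ] H) × (H →L[ℂ] H) :=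
    fun z => (z.1.toCLM, z.2.toCLM)
  -- The pairs subject to the constraints that averaging over the unitaries of `B m` preserves.
  let K : ℕ → Set ((H →L[ℂ] H) × (H →L[ℂ] H)) := fun m =>
    ((N : Set (H →L[ℂ] H)) ∩ {x | ‖x‖ ≤ ‖y‖}) ×ˢ
      ((R : Set (H →L[ℂ] H)) ∩ {x | ‖x‖ ≤ ‖p‖ ∧ Φ x = Φ p}) ∩
    {z | ∀ u ∈ B m, star u * u = 1 → u * star u = 1 →
      p * (u * z.1 * star u) * p = y * (p * (u * z.2 * star u) * p)}
  let T : ℕ → Set ((H →L[ℂ] H) × (H →L[ℂ] H)) := fun m =>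
    K m ∩ {z | ∀ b ∈ B m, b * z.1 = z.1 * b ∧ b * z.2 = z.2 * b}
  have hc1 : ∀ a b : H →L[ℂ] H, Continuous fun z : (H →WOT[ℂ] H) × (H →WOT[ℂ] H) =>
      (ofCLM (a * z.1.toCLM * b) : H →WOT[ℂ] H) := fun a b =>
    ((continuous_mul_right_wot b).comp (continuous_mul_left_wot a)).comp continuous_fst
  have hc2 : ∀ a b : H →L[ℂ] H, Continuous fun z : (H →WOT[ℂ] H) × (H →WOT[ℂ] H) =>
      (ofCLM (a * z.2.toCLM * b) : H →WOT[ℂ] H) := fun a b =>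
    ((continuous_mul_right_wot b).comp (continuous_mul_left_wot a)).comp continuous_snd
  have hcoord : IsClosed (wp ⁻¹' (((N : Set (H →L[ℂ] H)) ∩ {x | ‖x‖ ≤ ‖y‖}) ×ˢ
      ((R : Set (H →L[ℂ] H)) ∩ {x | ‖x‖ ≤ ‖p‖ ∧ Φ x = Φ p}))) :=
    IsClosed.prod (N.isWOTClosed_coe.inter (isWOTClosed_closedBall _))
      (R.isWOTClosed_coe.inter (hΦ.isWOTClosed_setOf_eq _ _))
  have hKcl : ∀ m, IsClosed (wp ⁻¹' K m) := fun m => by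
    have heq : wp ⁻¹' {z | ∀ u ∈ B m, star u * u = 1 → u * star u = 1 →
        p * (u * z.1 * star u) * p = y * (p * (u * z.2 * star u) * p)} =
        ⋂ (u) (_ : u ∈ B m) (_ : star u * u = 1) (_ : u * star u = 1),
          {z | (ofCLM (p * u * z.1.toCLM * (star u * p)) : H →WOT[ℂ] H) =
            ofCLM (y * (p * u) * z.2.toCLM * (star u * p))} := by
      ext z
      simp only [Set.mem_preimage, Set.mem_ofPred_eq, Set.mem_iInter, wp, ofCLM_injective.eq_iff,
        mul_assoc]
    rw [Set.preimage_inter, heq]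
    exact hcoord.inter (isClosed_iInter fun u => isClosed_iInter fun _ => isClosed_iInter fun _ =>
      isClosed_iInter fun _ => isClosed_eq (hc1 _ _) (hc2 _ _))
  have hTcl : ∀ m, IsClosed (wp ⁻¹' T m) := fun m => by
    have heq : wp ⁻¹' {z | ∀ b ∈ B m, b * z.1 = z.1 * b ∧ b * z.2 = z.2 * b} =
        ⋂ (b) (_ : b ∈ B m),
          {z | (ofCLM (b * z.1.toCLM * 1) : H →WOT[ℂ] H) = ofCLM (1 * z.1.toCLM * b)} ∩
          {z | (ofCLM (b * z.2.toCLM * 1) : H →WOT[ℂ] H) = ofCLM (1 * z.2.toCLM * b)} := by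
      ext z
      simp only [Set.mem_preimage, Set.mem_ofPred_eq, Set.mem_iInter, Set.mem_inter_iff, wp,
        ofCLM_injective.eq_iff, mul_one, one_mul]
    rw [Set.preimage_inter, heq]
    exact (hKcl m).inter (isClosed_iInter fun b => isClosed_iInter fun _ =>
      (isClosed_eq (hc1 _ _) (hc1 _ _)).inter (isClosed_eq (hc2 _ _) (hc2 _ _)))
  have hT0 : IsCompact (wp ⁻¹' T 0) := by
    refine IsCompact.of_isClosed_subset ((isCompact_wot_closedBall ‖y‖).prod
      (isCompact_wot_closedBall ‖p‖)) (hTcl 0) ?_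
    rintro z ⟨⟨⟨hz1, hz2⟩, -⟩, -⟩
    exact ⟨hz1.2, hz2.2.1⟩
  have hTne : ∀ m, (wp ⁻¹' T m).Nonempty := fun m => by
    have := hfd m
    have hof : Continuous fun z : (H →L[ℂ] H) × (H →L[ℂ] H) =>
        ((ofCLM z.1 : H →WOT[ℂ] H), (ofCLM z.2 : H →WOT[ℂ] H)) := by
      have h : Continuous (ofCLM : (H →L[ℂ] H) → (H →WOT[ℂ] H)) := by
        refine continuous_iff.2 fun ξ η => ?_
        simp only [ofCLM_apply]
        fun_prop
      exact (h.comp continuous_fst).prodMk (h.comp continuous_snd)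
    have hcl : IsClosed (K m) := (hKcl m).preimage hof
    have hconv : Convex ℝ (K m) := by
      have hball : ∀ C : ℝ, Convex ℝ {x : H →L[ℂ] H | ‖x‖ ≤ C} := fun C => by
        have h : {x : H →L[ℂ] H | ‖x‖ ≤ C} = Metric.closedBall 0 C := by ext; simp
        rw [h]; exact convex_closedBall _ _
      have hΦc : Convex ℝ {x : H →L[ℂ] H | ‖x‖ ≤ ‖p‖ ∧ Φ x = Φ p} := by
        refine (hball ‖p‖).inter ?_
        exact (convex_singleton (𝕜 := ℝ) (Φ p)).linear_preimage (Φ.restrictScalars ℝ)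
      refine ((N.convex_coe.inter (hball _)).prod (R.convex_coe.inter hΦc)).inter ?_
      intro z hz w hw s t _ _ _ u hu h1 h2
      have e1 := hz u hu h1 h2
      have e2 := hw u hu h1 h2
      simp only [Prod.fst_add, Prod.snd_add, Prod.smul_fst, Prod.smul_snd, mul_add, add_mul,
        mul_smul_comm, smul_mul_assoc, e1, e2]
    have hstart : (y, p) ∈ K m := by
      refine ⟨⟨⟨hyN, le_refl ‖y‖⟩, ⟨hpR, le_refl ‖p‖, rfl⟩⟩, fun u hu _ _ => ?_⟩
      have e1 : p * (u * y * star u) * p = p * u * p * y * (p * star u * p) := by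
        conv_lhs => rw [hpy]
        simp only [mul_assoc]
      have e2 : y * (p * (u * p * star u) * p) = y * (p * u * p) * (p * star u * p) := by
        have : p * (u * p * star u) * p = p * u * p * (p * star u * p) := by
          simp only [mul_assoc]; rw [← mul_assoc p p, hpp]
        rw [this, ← mul_assoc]
      change p * (u * y * star u) * p = y * (p * (u * p * star u) * p)
      rw [e1, e2, hcomm m u hu]
    have hinv : ∀ u ∈ B m, star u * u = 1 → u * star u = 1 →
        ∀ z ∈ K m, (u * z.1 * star u, u * z.2 * star u) ∈ K m := by
      rintro u hu h1 h2 z ⟨⟨⟨hz1, hz1'⟩, hz2, hz2', hz2''⟩, hz⟩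
      have huR := hBR m u hu
      refine ⟨⟨⟨mul_mem (mul_mem (hRN huR) hz1) (star_mem (hRN huR)),
        (norm_conj_le h1 _).trans hz1'⟩, mul_mem (mul_mem huR hz2) (star_mem huR),
        (norm_conj_le h1 _).trans hz2', ?_⟩, fun w hw hw1 hw2 => ?_⟩
      · rw [hΦ.tracial _ (mul_mem huR hz2) _ (star_mem huR), ← mul_assoc, h1, one_mul, hz2'']
      · have := hz (w * u) (mul_mem hw hu)
          (by rw [star_mul, mul_assoc, ← mul_assoc (star w), hw1, one_mul, h1])
          (by rw [star_mul, mul_assoc, ← mul_assoc u, h2, one_mul, hw2])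
        simpa only [star_mul, mul_assoc] using this
    obtain ⟨z, hzK, hz⟩ := exists_pair_commute_of_finiteDimensional (B m) hconv hcl ⟨_, hstart⟩ hinv
    exact ⟨(ofCLM z.1, ofCLM z.2), hzK, hz⟩
  obtain ⟨z, hz⟩ := IsCompact.nonempty_iInter_of_sequence_nonempty_isCompact_isClosed
    (fun m => wp ⁻¹' T m)
    (fun m z hz => ⟨⟨hz.1.1, fun u hu => hz.1.2 u (hmono (Nat.le_succ m) hu)⟩,
      fun b hb => hz.2 b (hmono (Nat.le_succ m) hb)⟩) hTne hT0 hTcl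
  have hz' : ∀ m, wp z ∈ T m := fun m => Set.mem_iInter.1 hz m
  have hscal : ∀ x ∈ N, (∀ m, ∀ b ∈ B m, b * x = x * b) → ∃ c : ℂ, x = c • (1 : H →L[ℂ] H) := by
    intro x hxN hx
    have h1 : x ∈ (R.commutant : Set (H →L[ℂ] H)) := by
      rw [coe_commutant, ← hgen, Set.centralizer_centralizer_centralizer]
      intro b hb
      obtain ⟨m, hm⟩ := Set.mem_iUnion.1 hb
      exact hx m b hm
    have h2 : x ∈ (R.commutant : Set (H →L[ℂ] H)) ∩ N := ⟨h1, hxN⟩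
    rw [herg] at h2
    obtain ⟨c, hc⟩ := h2
    exact ⟨c, hc.symm⟩
  obtain ⟨⟨⟨⟨hY, -⟩, ⟨hP, -, hPΦ⟩⟩, hrel⟩, -⟩ := hz' 0
  obtain ⟨c, hc⟩ := hscal _ hY fun m b hb => ((hz' m).2 b hb).1
  obtain ⟨d, hd⟩ := hscal _ (hRN hP) fun m b hb => ((hz' m).2 b hb).2
  have hd0 : d ≠ 0 := by
    rintro rfl
    rw [hd, zero_smul, map_zero] at hPΦ
    exact hp0 (hΦ.eq_zero_of_projection hpR hp hPΦ.symm)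
  have h1 := hrel 1 (one_mem _) (by simp) (by simp)
  rw [hc, hd] at h1
  simp only [star_one, mul_one, mul_smul_comm, smul_mul_assoc, hpp, hyp] at h1
  refine ⟨d⁻¹ * c, ?_⟩
  rw [mul_smul, h1, smul_smul, inv_mul_cancel₀ hd0, one_smul]

/-- The union of the finite-dimensional algebras generating an ergodic hyperfinite `II₁` factor
is an averaging subalgebra. -/
theorem isAveragingSubalgebra_of_hyperfinite {M N R : VonNeumannAlgebra H} (hMN : M ≤ N)
    (hRM : R ≤ M) (hR : R.IsHyperfiniteII1Factor) (herg : R.IsErgodic N) :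
    ∃ C, M.IsAveragingSubalgebra N C := by
  obtain ⟨hII, B, hmono, hfd, hgen⟩ := hR
  obtain ⟨Φ, hΦ⟩ := hII.exists_isTraceFunctional
  have hBR : ∀ m, ∀ b ∈ B m, b ∈ R := fun m b hb => by
    rw [← SetLike.mem_coe, ← hgen]
    exact Set.subset_centralizer_centralizer (Set.mem_iUnion.2 ⟨m, hb⟩)
  have hC : ∀ c, c ∈ ⨆ n, B n ↔ ∃ n, c ∈ B n := fun c => by
    rw [← SetLike.mem_coe, StarSubalgebra.coe_iSup_of_directed hmono.directed_le]
    simp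
  have hRN : R ≤ N := hRM.trans hMN
  refine ⟨⨆ n, B n, ?_, ?_, ?_, ?_⟩
  · intro c hc
    obtain ⟨n, hn⟩ := (hC c).1 hc
    exact hRM (hBR n c hn)
  · intro p hpC hp x hx hpx
    obtain ⟨n, hpn⟩ := (hC p).1 hpC
    have hpR := hBR n p hpn
    have hpp : p * p = p := hp.isIdempotentElem
    by_cases hp0 : p = 0
    · refine ⟨0, ?_⟩
      rw [zero_smul]
      have : x = 0 := by rw [hpx, hp0]; simp
      rw [this]; exact self_mem_averages
    -- Averages over the unitaries of `B (n + m)` commuting with `p` commute with `p (B (n + m)) p`.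
    let S : ℕ → Set (H →L[ℂ] H) := fun m =>
      M.averages p x ∩ {y | ∀ b ∈ B (n + m), p * b * p * y = y * (p * b * p)}
    have hScl : ∀ m, IsWOTClosed (S m) := fun m => by
      refine isWOTClosed_averages.inter ?_
      have := isWOTClosed_centralizer ((fun b => p * b * p) '' (B (n + m) : Set (H →L[ℂ] H)))
      convert this using 1
      ext y
      simp [Set.mem_centralizer_iff]
    have hSne : ∀ m, (S m).Nonempty := fun m => by
      let B' := B (n + m) ⊓ StarSubalgebra.centralizer ℂ {p}
      have hB' : ∀ b, b ∈ B' ↔ b ∈ B (n + m) ∧ p * b = b * p := fun b => by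
        simp only [B', StarSubalgebra.mem_inf, StarSubalgebra.mem_centralizer_iff,
          Set.mem_singleton_iff, forall_eq, hp.isSelfAdjoint.star_eq, and_self]
      have := hfd (n + m)
      have : FiniteDimensional ℂ B' := by
        have hle : Subalgebra.toSubmodule B'.toSubalgebra ≤
            Subalgebra.toSubmodule (B (n + m)).toSubalgebra := fun b hb => ((hB' b).1 hb).1
        have : FiniteDimensional ℂ (Subalgebra.toSubmodule (B (n + m)).toSubalgebra) :=
          inferInstanceAs (FiniteDimensional ℂ (B (n + m)))
        exact Submodule.finiteDimensional_of_le hle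
      obtain ⟨y, hy, hyB⟩ := exists_commute_of_finiteDimensional B' (K := M.averages p x)
        convex_averages isWOTClosed_averages.isClosed ⟨x, self_mem_averages⟩
        fun u hu h1 h2 y hy => conj_mem_averages
          ⟨hRM (hBR _ u ((hB' u).1 hu).1), ⟨h1, h2⟩, ((hB' u).1 hu).2.symm⟩ hy
      have hpm : p ∈ B (n + m) := hmono (Nat.le_add_right n m) hpn
      refine ⟨y, hy, fun b hb => hyB _ ((hB' _).2 ⟨mul_mem (mul_mem hpm hb) hpm, ?_⟩)⟩
      rw [mul_assoc _ p p, hpp, ← mul_assoc, ← mul_assoc, hpp]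
    obtain ⟨y, hy⟩ := exists_mem_forall_of_antitone (S := S) (C := ‖x‖)
      (fun i j hij y hy => ⟨hy.1, fun b hb => hy.2 b (hmono (Nat.add_le_add_left hij n) hb)⟩)
      hSne hScl (fun y hy => norm_le_of_mem_averages hy.1)
    obtain ⟨c, hc⟩ := exists_eq_smul_of_commute_corner hRN herg hmono hfd hgen hΦ hpR hp hp0
      (averages_subset_coe hMN hx (hy 0).1) (corner_of_mem_averages hpx (hy 0).1)
      (fun m b hb => ((hy m).2 b (hmono (Nat.le_add_left m n) hb)).symm)
    exact ⟨c, hc ▸ (hy 0).1⟩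
  · intro e heC he hmin x hx
    obtain ⟨n, hen⟩ := (hC e).1 heC
    have heR := hBR n e hen
    have hee : e * e = e := he.isIdempotentElem
    by_cases he0 : e = 0
    · exact ⟨0, by simp [he0]⟩
    refine exists_eq_smul_of_commute_corner hRN herg hmono hfd hgen hΦ heR he he0
      (mul_mem (mul_mem (hRN heR) hx) (hRN heR)) ?_ fun m b hb => ?_
    · simp only [mul_assoc, hee]; rw [← mul_assoc e e, hee]
    · obtain ⟨l, hl⟩ := hmin b ((hC b).2 ⟨m, hb⟩)
      rw [hl, mul_smul_comm, smul_mul_assoc, mul_assoc _ e e, hee, ← mul_assoc, ← mul_assoc, hee]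
  · intro c hc hcs
    obtain ⟨n, hn⟩ := (hC c).1 hc
    have := hfd n
    obtain ⟨r, hr, h⟩ := exists_spectral_projection_of_finiteDimensional (B n) hn hcs
    exact ⟨r, (hC r).2 ⟨n, hr⟩, h⟩

/-! ### Permanence properties of mean-value ergodic corners -/

theorem norm_eq_one_of_isStarProjection {q : H →L[ℂ] H} (hq : IsStarProjection q) (h0 : q ≠ 0) :
    ‖q‖ = 1 := by
  have h := CStarRing.norm_star_mul_self (x := q)
  rw [hq.isSelfAdjoint.star_eq, hq.isIdempotentElem.eq] at h
  exact (mul_right_cancel₀ (norm_ne_zero_iff.2 h0) (by rw [one_mul]; exact h)).symm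

theorem isMVErgodicAt_zero (M N : VonNeumannAlgebra H) : M.IsMVErgodicAt N 0 := fun x _ hx =>
  ⟨0, by
    have : x = 0 := by rw [hx]; simp
    rw [this, zero_smul]; exact self_mem_averages⟩

/-- Projections `q ≤ p` have projections `p - q` as complement. -/
theorem isStarProjection_sub {p q : H →L[ℂ] H} (hp : IsStarProjection p) (hq : IsStarProjection q)
    (hpq : p * q = q) : q * p = q ∧ IsStarProjection (p - q) := by
  have h := congrArg star hpq
  rw [star_mul, hp.isSelfAdjoint.star_eq, hq.isSelfAdjoint.star_eq] at h
  refine ⟨h, ?_, hp.isSelfAdjoint.sub hq.isSelfAdjoint⟩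
  rw [IsIdempotentElem, mul_sub, sub_mul, sub_mul, hp.isIdempotentElem.eq, hpq, h,
    hq.isIdempotentElem.eq]
  abel

/-- Averaging over the unitaries of `q M q` and the symmetry `q - (p - q)` turns an element of
`p N p` into a scalar on a mean-value ergodic subprojection `q` of `p`, without changing the corner
at `p - q`. -/
theorem IsMVErgodicAt.exists_add_mem_averages {M N : VonNeumannAlgebra H} (hMN : M ≤ N)
    {p q x : H →L[ℂ] H} (hpM : p ∈ M) (hqM : q ∈ M) (hp : IsStarProjection p)
    (hq : IsStarProjection q) (hpq : p * q = q) (hgood : M.IsMVErgodicAt N q) (hx : x ∈ N)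
    (hpx : x = p * x * p) :
    ∃ c : ℂ, ‖c‖ ≤ ‖x‖ ∧ c • q + (p - q) * x * (p - q) ∈ M.averages p x := by
  obtain ⟨hqp, hf⟩ := isStarProjection_sub hp hq hpq
  have hqs : star q = q := hq.isSelfAdjoint
  have hqq : q * q = q := hq.isIdempotentElem
  have hpp : p * p = p := hp.isIdempotentElem
  have hfs : star (p - q) = p - q := hf.isSelfAdjoint
  have hff : (p - q) * (p - q) = p - q := hf.isIdempotentElem
  have hqf : q * (p - q) = 0 := by rw [mul_sub, hqp, hqq, sub_self]
  have hfq : (p - q) * q = 0 := by rw [sub_mul, hpq, hqq, sub_self]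
  have hpx' : p * x = x := by rw [hpx, ← mul_assoc, ← mul_assoc, hpp]
  have hxp : x * p = x := by
    conv_lhs => rw [hpx]
    rw [mul_assoc, hpp, ← hpx]
  obtain ⟨c, hc⟩ := hgood (q * x * q) (mul_mem (mul_mem (hMN hqM) hx) (hMN hqM)) (by
    simp only [mul_assoc, hqq]; rw [← mul_assoc q q, hqq])
  have hcut : ∀ y ∈ M.averages q (q * x * q),
      y + (p - q) * x * (p - q) ∈ M.averages p x := by
    let s : H →L[ℂ] H := 1 - (2 : ℝ) • (p - q)
    have hss : star s = s := by
      simp only [s, star_sub, star_one, star_smul, star_trivial (2 : ℝ)]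
      rw [← star_sub, hfs]
    have hs2 : s * s = 1 := by
      simp only [s]
      rw [sub_mul, one_mul, mul_sub, mul_one, smul_mul_smul_comm, hff]
      module
    have hpf : p * (p - q) = p - q := by rw [mul_sub, hpp, hpq]
    have hfp : (p - q) * p = p - q := by rw [sub_mul, hpp, hqp]
    have hs : s ∈ M.reducingUnitaries p := by
      refine ⟨sub_mem (one_mem M) (M.real_smul_mem_coe _ (sub_mem hpM hqM)),
        by rw [hss]; exact ⟨hs2, hs2⟩, ?_⟩
      simp only [s]
      rw [sub_mul, mul_sub, one_mul, mul_one, smul_mul_assoc, mul_smul_comm, hpf, hfp]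
    have hmid : q * x * q + (p - q) * x * (p - q) ∈ M.averages p x := by
      have h := convex_averages (M := M) (p := p) (x := x) self_mem_averages
        (conj_mem_averages_self hs) (a := 1 / 2) (b := 1 / 2) (by norm_num) (by norm_num)
        (by norm_num)
      have e : (1 / 2 : ℝ) • x + (1 / 2 : ℝ) • (s * x * star s) =
          q * x * q + (p - q) * x * (p - q) := by
        have hqxp : q * x * p = q * x := by rw [mul_assoc, hxp]
        rw [hss]
        simp only [s, sub_mul, mul_sub, one_mul, mul_one, smul_mul_assoc, mul_smul_comm, smul_sub,
          smul_smul, hpx', hxp, hqxp]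
        module
      rwa [e] at h
    intro y hy
    refine averages_subset_of_mem hmid ?_
    have := conj_add_mem_of_mem_weakClosedConvexHull 1 1 ((p - q) * x * (p - q)) convex_averages
      (isWOTClosed_averages (M := M) (p := p) (x := q * x * q + (p - q) * x * (p - q))) ?_ hy
    · simpa using this
    · rintro _ ⟨u, hu, rfl⟩
      have hus := star_mul_comm_of_mem hu
      obtain ⟨huM, ⟨hu1, hu2⟩, huq⟩ := hu
      let w := u * q + (1 - q)
      have hws : star w = q * star u + (1 - q) := by
        simp only [w, star_add, star_mul, star_sub, star_one, hqs]
      have hquq : q * (u * q) = u * q := by rw [huq, ← mul_assoc, hqq]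
      have hw : w ∈ M.reducingUnitaries p := by
        refine ⟨add_mem (mul_mem huM hqM) (sub_mem (one_mem M) hqM), ⟨?_, ?_⟩, ?_⟩
        · rw [hws]
          have e1 : q * star u * (u * q) = q := by
            rw [mul_assoc, ← mul_assoc (star u), hu1, one_mul, hqq]
          have e2 : q * star u * (1 - q) = 0 := by
            rw [← hus, mul_assoc, mul_sub, mul_one, hqq, sub_self, mul_zero]
          have e3 : (1 - q) * (u * q) = 0 := by rw [sub_mul, one_mul, hquq, sub_self]
          have e4 : (1 - q) * (1 - q) = 1 - q := hq.one_sub.isIdempotentElem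
          simp only [w]
          rw [add_mul, mul_add, mul_add, e1, e2, e3, e4]
          abel
        · rw [hws]
          have e1 : u * q * (q * star u) = q := by
            rw [mul_assoc, ← mul_assoc q q, hqq, ← hus, ← mul_assoc, hu2, one_mul]
          have e2 : u * q * (1 - q) = 0 := by rw [mul_assoc, mul_sub, mul_one, hqq, sub_self,
            mul_zero]
          have e3 : (1 - q) * (q * star u) = 0 := by
            rw [← mul_assoc, sub_mul, one_mul, hqq, sub_self, zero_mul]
          have e4 : (1 - q) * (1 - q) = 1 - q := hq.one_sub.isIdempotentElem
          simp only [w]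
          rw [add_mul, mul_add, mul_add, e1, e2, e3, e4]
          abel
        · simp only [w]
          rw [add_mul, mul_add, mul_assoc, hqp, sub_mul, mul_sub, one_mul, mul_one, hqp, hpq, huq,
            ← mul_assoc, hpq]
      have h := conj_mem_averages_self (M := M) (p := p)
        (x := q * x * q + (p - q) * x * (p - q)) hw
      have e1 : w * q = u * q := by
        simp only [w]; rw [add_mul, mul_assoc, hqq, sub_mul, one_mul, hqq, sub_self, add_zero]
      have e2 : q * star w = q * star u := by
        rw [hws, mul_add, ← mul_assoc, hqq, mul_sub, mul_one, hqq, sub_self, add_zero]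
      have e3 : w * (p - q) = p - q := by
        simp only [w]; rw [add_mul, mul_assoc, hqf, mul_zero, zero_add, sub_mul, one_mul, hqf,
          sub_zero]
      have e4 : (p - q) * star w = p - q := by
        rw [hws, mul_add, ← mul_assoc, hfq, zero_mul, zero_add, mul_sub, mul_one, hfq, sub_zero]
      have e : w * (q * x * q + (p - q) * x * (p - q)) * star w =
          1 * (u * (q * x * q) * star u) * 1 + (p - q) * x * (p - q) := by
        rw [mul_add, add_mul, one_mul, mul_one]
        congr 1
        · calc w * (q * x * q) * star w = w * q * x * (q * star w) := by simp only [mul_assoc]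
            _ = u * q * x * (q * star u) := by rw [e1, e2]
            _ = _ := by simp only [mul_assoc]
        · calc w * ((p - q) * x * (p - q)) * star w
              = w * (p - q) * x * ((p - q) * star w) := by simp only [mul_assoc]
            _ = _ := by rw [e3, e4]
      rwa [e] at h
  by_cases hq0 : q = 0
  · refine ⟨0, by simp, ?_⟩
    have h0 := hcut _ hc
    rw [hq0, smul_zero] at h0
    rw [hq0, smul_zero]
    exact h0
  · refine ⟨c, ?_, hcut _ hc⟩
    have h1 := norm_le_of_mem_averages hc
    have hq1 := norm_eq_one_of_isStarProjection hq hq0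
    rw [norm_smul, hq1, mul_one] at h1
    refine h1.trans ((norm_mul_le _ _).trans ?_)
    rw [hq1, mul_one]
    exact (norm_mul_le _ _).trans (by rw [hq1, one_mul])

/-- Mean-value ergodicity passes to sums of orthogonal projections: average to scalars on each
summand, then use averaging in the factor `M`. -/
theorem IsMVErgodicAt.add {M N : VonNeumannAlgebra H} (hM : M.IsFactor) (hMN : M ≤ N)
    {q₁ q₂ : H →L[ℂ] H} (hq₁M : q₁ ∈ M) (hq₂M : q₂ ∈ M) (hq₁ : IsStarProjection q₁)
    (hq₂ : IsStarProjection q₂) (hq : q₁ * q₂ = 0) (h₁ : M.IsMVErgodicAt N q₁)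
    (h₂ : M.IsMVErgodicAt N q₂) : M.IsMVErgodicAt N (q₁ + q₂) := by
  intro x hx hpx
  have hq' : q₂ * q₁ = 0 := by
    have := congrArg star hq
    rwa [star_mul, hq₁.isSelfAdjoint.star_eq, hq₂.isSelfAdjoint.star_eq, star_zero] at this
  have hp : IsStarProjection (q₁ + q₂) := ⟨by
    rw [IsIdempotentElem, mul_add, add_mul, add_mul, hq, hq', hq₁.isIdempotentElem.eq,
      hq₂.isIdempotentElem.eq, add_zero, zero_add], hq₁.isSelfAdjoint.add hq₂.isSelfAdjoint⟩
  have hpM : q₁ + q₂ ∈ M := add_mem hq₁M hq₂M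
  obtain ⟨c, -, hc⟩ := h₁.exists_add_mem_averages hMN hpM hq₁M hp hq₁
    (by rw [add_mul, hq', hq₁.isIdempotentElem.eq, add_zero]) hx hpx
  rw [add_sub_cancel_left] at hc
  have hyp := corner_of_mem_averages hpx hc
  obtain ⟨d, -, hd⟩ := h₂.exists_add_mem_averages hMN hpM hq₂M hp hq₂
    (by rw [add_mul, hq, hq₂.isIdempotentElem.eq, zero_add]) (averages_subset_coe hMN hx hc) hyp
  have e : d • q₂ + (q₁ + q₂ - q₂) * (c • q₁ + q₂ * x * q₂) * (q₁ + q₂ - q₂) =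
      d • q₂ + c • q₁ := by
    rw [add_sub_cancel_right, mul_add, add_mul, mul_smul_comm, smul_mul_assoc,
      hq₁.isIdempotentElem.eq, hq₁.isIdempotentElem.eq, ← mul_assoc, ← mul_assoc, hq, zero_mul,
      zero_mul, zero_mul, add_zero]
  rw [e] at hd
  obtain ⟨l, hl⟩ := hM.exists_smul_mem_averages hpM hp
    (add_mem (M.smul_mem_coe d hq₂M) (M.smul_mem_coe c hq₁M)) (corner_of_mem_averages hyp hd)
  exact ⟨l, averages_subset_of_mem hc (averages_subset_of_mem hd hl)⟩

/-- Mean-value ergodicity passes to Murray–von Neumann equivalent projections. -/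
theorem IsMVErgodicAt.of_partial_isometry {M N : VonNeumannAlgebra H} (hMN : M ≤ N)
    {v : H →L[ℂ] H} (hvM : v ∈ M) (hvvv : v * star v * v = v)
    (h : M.IsMVErgodicAt N (star v * v)) : M.IsMVErgodicAt N (v * star v) := by
  intro x hx hpx
  have hsM : star v ∈ M := star_mem hvM
  have hsvs : star v * v * star v = star v := by
    have := congrArg star hvvv
    rwa [star_mul, star_mul, star_star, ← mul_assoc] at this
  set q := star v * v with hq
  set e := v * star v with he
  have hvq : v * q = v := by rw [hq, ← mul_assoc]; exact hvvv
  have hqs : q * star v = star v := hsvs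
  have hse : star v * e = star v := by rw [he, ← mul_assoc]; exact hsvs
  have hee : e * e = e := by rw [he, mul_assoc, ← he, hse]
  have hex : e * x = x := by rw [hpx, mul_assoc e x e, ← mul_assoc e e, hee]
  have hxe : x * e = x := by
    conv_lhs => rw [hpx]
    rw [mul_assoc, hee, ← hpx]
  obtain ⟨c, hc⟩ := h (star v * x * v) (mul_mem (mul_mem (hMN hsM) hx) (hMN hvM)) (by
    calc star v * x * v = q * star v * x * (v * q) := by rw [hqs, hvq]
      _ = q * (star v * x * v) * q := by simp only [mul_assoc])
  refine ⟨c, ?_⟩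
  have := conj_add_mem_of_mem_weakClosedConvexHull v (star v) 0 convex_averages
    (isWOTClosed_averages (M := M) (p := e) (x := x)) ?_ hc
  · rwa [add_zero, mul_smul_comm, smul_mul_assoc, hvq] at this
  · rintro _ ⟨u, hu, rfl⟩
    have hus := star_mul_comm_of_mem hu
    obtain ⟨huM, ⟨hu1, hu2⟩, huq⟩ := hu
    let a := v * u * star v
    have has : star a = v * star u * star v := by
      simp only [a, star_mul, star_star, mul_assoc]
    have e1 : star a * a = e := by
      rw [has]
      calc v * star u * star v * (v * u * star v) = v * (star u * (q * u)) * star v := by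
            rw [hq]; simp only [mul_assoc]
        _ = e := by rw [← huq, ← mul_assoc (star u), hu1, one_mul, hvq]
    have e2 : a * star a = e := by
      rw [has]
      calc v * u * star v * (v * star u * star v) = v * (u * (q * star u)) * star v := by
            rw [hq]; simp only [mul_assoc]
        _ = e := by rw [← hus, ← mul_assoc u, hu2, one_mul, hvq]
    have hev : e * v = v := hvvv
    have hea : e * a = a := by simp only [a]; rw [← mul_assoc, ← mul_assoc, hev]
    have hae : a * e = a := by simp only [a]; rw [mul_assoc, hse]
    have hes : star e = e := by rw [he, star_mul, star_star]
    have hesa : e * star a = star a := by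
      have := congrArg star hae; rwa [star_mul, hes] at this
    have hsae : star a * e = star a := by
      have := congrArg star hea; rwa [star_mul, hes] at this
    let w := a + (1 - e)
    have hws : star w = star a + (1 - e) := by
      simp only [w, star_add, star_sub, star_one, hes]
    have hw : w ∈ M.reducingUnitaries e := by
      refine ⟨add_mem (mul_mem (mul_mem hvM huM) hsM) (sub_mem (one_mem M) (mul_mem hvM hsM)),
        ⟨?_, ?_⟩, ?_⟩
      · rw [hws]; simp only [w]
        simp only [add_mul, mul_add, sub_mul, mul_sub, one_mul, mul_one, e1, hee, hea, hsae]
        abel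
      · rw [hws]; simp only [w]
        simp only [add_mul, mul_add, sub_mul, mul_sub, one_mul, mul_one, e2, hee, hesa, hae]
        abel
      · simp only [w, add_mul, mul_add, sub_mul, mul_sub, one_mul, mul_one, hee, hea, hae]
    have hwx : w * x = a * x := by
      simp only [w]; rw [add_mul, sub_mul, one_mul, hex, sub_self, add_zero]
    have hxw : x * star w = x * star a := by
      rw [hws, mul_add, mul_sub, mul_one, hxe, sub_self, add_zero]
    have := conj_mem_averages_self (x := x) hw
    rw [hwx, mul_assoc, hxw, has] at this
    convert this using 1
    simp only [a, add_zero, mul_assoc]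

/-! ### Small projections in averaging subalgebras -/

/-- If every real multiple of `e` is comparable with `b`, then `b` is one of them, by connectedness of
the real line. -/
theorem eq_smul_of_forall_le_or_le {b e : H →L[ℂ] H} (hb : IsSelfAdjoint b)
    (he : IsStarProjection e) (hbe : e * b * e = b) (h : ∀ t : ℝ, t • e ≤ b ∨ b ≤ t • e) :
    ∃ t : ℝ, b = t • e := by
  have hcl1 : IsClosed {t : ℝ | t • e ≤ b} :=
    isClosed_le (by fun_prop) continuous_const
  have hcl2 : IsClosed {t : ℝ | b ≤ t • e} :=
    isClosed_le continuous_const (by fun_prop)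
  have hconj : ∀ s : ℝ, star e * (s • 1) * e = s • e := fun s => by
    rw [mul_smul_comm, smul_mul_assoc, mul_one, he.isSelfAdjoint.star_eq, he.isIdempotentElem.eq]
  have hstar : star e * b * e = b := by rw [he.isSelfAdjoint.star_eq, hbe]
  have hne2 : b ≤ ‖b‖ • e := by
    have := star_left_conjugate_le_conjugate (le_smul_one_of_norm_le hb le_rfl) e
    rwa [hconj, hstar] at this
  have hne1 : (-‖b‖) • e ≤ b := by
    have := star_left_conjugate_le_conjugate
      (le_smul_one_of_norm_le hb.neg (norm_neg b).le) e
    rw [hconj, mul_neg, neg_mul, hstar] at this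
    rw [neg_smul]; exact neg_le_of_neg_le this
  obtain ⟨t, -, ht1, ht2⟩ := isPreconnected_closed_iff.1 (isPreconnected_univ (α := ℝ)) _ _
    hcl1 hcl2 (fun t _ => h t) ⟨_, trivial, hne1⟩ ⟨_, trivial, hne2⟩
  exact ⟨t, le_antisymm ht2 ht1⟩

/-- For atoms `e`, `f` of `M`, the space `e M f` is at most one-dimensional. -/
theorem exists_corner_le_span {M : VonNeumannAlgebra H} {e f : H →L[ℂ] H}
    (heM : e ∈ M) (hfM : f ∈ M) (he : IsStarProjection e) (hf : IsStarProjection f)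
    (hmin : ∀ x ∈ M, ∃ l : ℂ, e * x * e = l • e) (hmin' : ∀ x ∈ M, ∃ l : ℂ, f * x * f = l • f) :
    ∃ v : H →L[ℂ] H, ∀ x ∈ M, e * x * f ∈ Submodule.span ℂ {v} := by
  have hff : f * f = f := hf.isIdempotentElem
  have hee : e * e = e := he.isIdempotentElem
  by_cases h : ∀ x ∈ M, e * x * f = 0
  · exact ⟨0, fun x hx => by rw [h x hx]; exact zero_mem _⟩
  push Not at h
  obtain ⟨x₀, hx₀, hv0⟩ := h
  refine ⟨e * x₀ * f, fun x hx => ?_⟩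
  set v := e * x₀ * f with hv
  have hvM : v ∈ M := mul_mem (mul_mem heM hx₀) hfM
  have hvs : star v = f * star x₀ * e := by
    rw [hv, star_mul, star_mul, he.isSelfAdjoint.star_eq, hf.isSelfAdjoint.star_eq, mul_assoc]
  obtain ⟨α, hα⟩ := hmin (x₀ * f * star x₀) (mul_mem (mul_mem hx₀ hfM) (star_mem hx₀))
  obtain ⟨β, hβ⟩ := hmin' (star x₀ * e * x) (mul_mem (mul_mem (star_mem hx₀) heM) hx)
  have h1 : v * star v = α • e := by
    rw [← hα, hvs, hv]; simp only [mul_assoc]; rw [← mul_assoc f f, hff]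
  have h2 : star v * (e * x * f) = β • f := by
    rw [← hβ, hvs]; simp only [mul_assoc]; rw [← mul_assoc e e, hee]
  have hα0 : α ≠ 0 := by
    rintro rfl
    rw [zero_smul, CStarRing.mul_star_self_eq_zero_iff] at h1
    exact hv0 h1
  have h3 : α • (e * x * f) = β • v := by
    have hvf : v * f = v := by rw [hv, mul_assoc, hff]
    calc α • (e * x * f) = (α • e) * (e * x * f) := by
          rw [smul_mul_assoc, ← mul_assoc, ← mul_assoc, hee]
      _ = β • v := by rw [← h1, mul_assoc, h2, mul_smul_comm, hvf]
  rw [Submodule.mem_span_singleton]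
  exact ⟨α⁻¹ * β, by rw [mul_smul, ← h3, smul_smul, inv_mul_cancel₀ hα0, one_smul]⟩

namespace IsAveragingSubalgebra

variable {M N : VonNeumannAlgebra H} {C : StarSubalgebra ℂ (H →L[ℂ] H)}

/-- A projection of `C` is an atom of `C`, or it can be split inside `C`. -/
theorem minimal_or_exists_lt (hC : M.IsAveragingSubalgebra N C) {e : H →L[ℂ] H} (heC : e ∈ C)
    (he : IsStarProjection e) : (∀ c ∈ C, ∃ l : ℂ, e * c * e = l • e) ∨
      ∃ f ∈ C, IsStarProjection f ∧ e * f = f ∧ f ≠ 0 ∧ f ≠ e := by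
  have hee : e * e = e := he.isIdempotentElem
  have hes : star e = e := he.isSelfAdjoint
  by_contra! hcon
  obtain ⟨⟨c, hcC, hc⟩, hf⟩ := hcon
  -- Spectral projections of `b - t e` under `e` are `0` or `e`, so that `b` compares with `t e`.
  have hsa : ∀ b ∈ C, IsSelfAdjoint b → e * b * e = b → ∃ t : ℝ, b = t • e := by
    intro b hbC hb hbe
    refine eq_smul_of_forall_le_or_le hb he hbe fun t => ?_
    have heb : e * b = b := by rw [← hbe, ← mul_assoc, ← mul_assoc, hee]
    have hbe' : b * e = b := by
      have := congrArg star heb; rwa [star_mul, hb.star_eq, hes] at this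
    have htC : t • e ∈ C := by
      have h : t • e = (t : ℂ) • e := by ext; simp
      rw [h]; exact C.smul_mem heC _
    have ha : IsSelfAdjoint (b - t • e) := hb.sub ((IsSelfAdjoint.all t).smul he.isSelfAdjoint)
    obtain ⟨r, hrC, hr, hrc, h1, h2⟩ := hC.spectral (b - t • e) (sub_mem hbC htC) ha
    have hae : (b - t • e) * e = b - t • e := by
      rw [sub_mul, hbe', smul_mul_assoc, hee]
    have hea : e * (b - t • e) = b - t • e := by
      rw [mul_sub, heb, mul_smul_comm, hee]
    have her : e * r = r * e := hrc e (by rw [hae, hea])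
    have hproj : IsStarProjection (e * r) := ⟨by
      rw [IsIdempotentElem, her, mul_assoc, ← mul_assoc e, her, mul_assoc r e e, hee, ← mul_assoc,
        hr.isIdempotentElem.eq], by
      rw [IsSelfAdjoint, star_mul, hes, hr.isSelfAdjoint.star_eq, her]⟩
    by_cases h0 : e * r = 0
    · right
      have : (b - t • e) * (1 - r) = b - t • e := by
        rw [← hae, mul_assoc, mul_sub, h0, mul_one, sub_zero]
      rw [this] at h2
      exact sub_nonpos.1 h2
    · left
      have h3 := hf (e * r) (mul_mem heC hrC) hproj (by rw [← mul_assoc, hee]) h0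
      have : (b - t • e) * r = b - t • e := by
        rw [← hae, mul_assoc, h3]
      rw [this] at h1
      exact sub_nonneg.1 h1
  have hcorner : ∀ b : H →L[ℂ] H, e * (e * b * e) * e = e * b * e := fun b => by
    simp only [mul_assoc, hee]; rw [← mul_assoc e e, hee]
  have hdC : e * c * e ∈ C := mul_mem (mul_mem heC hcC) heC
  have hds : star (e * c * e) ∈ C := star_mem hdC
  have hdsc : e * star (e * c * e) * e = star (e * c * e) := by
    have := congrArg star (hcorner c)
    rw [star_mul, star_mul (e) (e * c * e), hes, ← mul_assoc] at this
    exact this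
  obtain ⟨s, hs⟩ := hsa (e * c * e + star (e * c * e)) (add_mem hdC hds)
    (IsSelfAdjoint.add_star_self _) (by rw [mul_add, add_mul, hcorner, hdsc])
  obtain ⟨t, ht⟩ := hsa (Complex.I • (e * c * e - star (e * c * e)))
    (C.smul_mem (sub_mem hdC hds) _) (by
      rw [IsSelfAdjoint, star_smul, star_sub, star_star, Complex.star_def, Complex.conj_I]
      module) (by rw [mul_smul_comm, smul_mul_assoc, mul_sub, sub_mul, hcorner, hdsc])
  refine hc ((s : ℂ) / 2 - Complex.I * (t / 2)) ?_
  have hreal : ∀ r : ℝ, r • e = (r : ℂ) • e := fun r => by ext; simp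
  rw [hreal] at hs ht
  have hI : e * c * e - star (e * c * e) = -Complex.I • (t : ℂ) • e := by
    rw [← ht, smul_smul]; simp
  calc e * c * e = (1 / 2 : ℂ) • ((e * c * e + star (e * c * e)) +
        (e * c * e - star (e * c * e))) := by module
    _ = _ := by rw [hs, hI]; module

/-- If the nonzero projections of `C` have trace bounded below, then they are finite sums of
atoms: a property of atoms that is additive holds for all projections of `C`. -/
theorem induction_of_trace_ge (hC : M.IsAveragingSubalgebra N C) {Φ : (H →L[ℂ] H) →ₗ[ℂ] ℂ}
    {ε : ℝ} (hε : 0 < ε) (hbd : ∀ r ∈ C, IsStarProjection r → r ≠ 0 → ε ≤ (Φ r).re)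
    {P : (H →L[ℂ] H) → Prop} (h0 : P 0)
    (hmin : ∀ e ∈ C, IsStarProjection e → (∀ c ∈ C, ∃ l : ℂ, e * c * e = l • e) → P e)
    (hadd : ∀ e f, P e → P f → P (e + f)) {e : H →L[ℂ] H} (heC : e ∈ C)
    (he : IsStarProjection e) : P e := by
  have key : ∀ n : ℕ, ∀ e ∈ C, IsStarProjection e → (Φ e).re < n * ε → P e := by
    intro n
    induction n with
    | zero =>
      intro e heC he hlt
      by_cases h : e = 0
      · rw [h]; exact h0
      · have := hbd e heC he h
        simp only [Nat.cast_zero, zero_mul] at hlt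
        linarith
    | succ n ih =>
      intro e heC he hlt
      push_cast at hlt
      rcases hC.minimal_or_exists_lt heC he with h | ⟨f, hfC, hf, hef, hf0, hfe⟩
      · exact hmin e heC he h
      · have hsub := (isStarProjection_sub he hf hef).2
        have h1 := hbd f hfC hf hf0
        have h2 := hbd (e - f) (sub_mem heC hfC) hsub (sub_ne_zero.2 hfe.symm)
        have h3 : (Φ (e - f)).re = (Φ e).re - (Φ f).re := by rw [map_sub, Complex.sub_re]
        rw [show e = f + (e - f) by abel]
        exact hadd _ _ (ih f hfC hf (by linarith)) (ih _ (sub_mem heC hfC) hsub (by linarith))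
  obtain ⟨n, hn⟩ := exists_nat_gt ((Φ e).re / ε)
  exact key n e heC he ((div_lt_iff₀ hε).1 hn)

/-- An averaging subalgebra of a `II₁` factor contains nonzero projections of arbitrarily small
trace; otherwise `1` would be a finite sum of atoms and `M` would be finite-dimensional. -/
theorem exists_trace_lt (hC : M.IsAveragingSubalgebra N C) (hMN : M ≤ N)
    (hinf : ¬ FiniteDimensional ℂ M.toStarSubalgebra) (Φ : (H →L[ℂ] H) →ₗ[ℂ] ℂ) {ε : ℝ}
    (hε : 0 < ε) : ∃ r ∈ C, IsStarProjection r ∧ r ≠ 0 ∧ (Φ r).re < ε := by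
  by_contra! hbd
  refine hinf ?_
  have hsup : ∀ e f g : H →L[ℂ] H,
      (∃ W : Submodule ℂ (H →L[ℂ] H), FiniteDimensional ℂ W ∧ ∀ x ∈ M, e * x * g ∈ W) →
      (∃ W : Submodule ℂ (H →L[ℂ] H), FiniteDimensional ℂ W ∧ ∀ x ∈ M, f * x * g ∈ W) →
      ∃ W : Submodule ℂ (H →L[ℂ] H), FiniteDimensional ℂ W ∧ ∀ x ∈ M, (e + f) * x * g ∈ W := by
    rintro e f g ⟨W, hW, h⟩ ⟨W', hW', h'⟩
    refine ⟨W ⊔ W', inferInstance, fun x hx => ?_⟩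
    rw [add_mul, add_mul]
    exact add_mem (Submodule.mem_sup_left (h x hx)) (Submodule.mem_sup_right (h' x hx))
  have hsup' : ∀ e f g : H →L[ℂ] H,
      (∃ W : Submodule ℂ (H →L[ℂ] H), FiniteDimensional ℂ W ∧ ∀ x ∈ M, g * x * e ∈ W) →
      (∃ W : Submodule ℂ (H →L[ℂ] H), FiniteDimensional ℂ W ∧ ∀ x ∈ M, g * x * f ∈ W) →
      ∃ W : Submodule ℂ (H →L[ℂ] H), FiniteDimensional ℂ W ∧ ∀ x ∈ M, g * x * (e + f) ∈ W := by
    rintro e f g ⟨W, hW, h⟩ ⟨W', hW', h'⟩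
    refine ⟨W ⊔ W', inferInstance, fun x hx => ?_⟩
    rw [mul_add]
    exact add_mem (Submodule.mem_sup_left (h x hx)) (Submodule.mem_sup_right (h' x hx))
  have hatom : ∀ e ∈ C, IsStarProjection e → (∀ c ∈ C, ∃ l : ℂ, e * c * e = l • e) →
      ∀ x ∈ M, ∃ l : ℂ, e * x * e = l • e := fun e heC he h x hx =>
    hC.corner_eq e heC he h x (hMN hx)
  have hone : IsStarProjection (1 : H →L[ℂ] H) := .one _
  obtain ⟨W, hW, hMW⟩ : ∃ W : Submodule ℂ (H →L[ℂ] H), FiniteDimensional ℂ W ∧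
      ∀ x ∈ M, 1 * x * 1 ∈ W := by
    refine hC.induction_of_trace_ge hε hbd
      (P := fun e => ∃ W : Submodule ℂ (H →L[ℂ] H), FiniteDimensional ℂ W ∧ ∀ x ∈ M, e * x * 1 ∈ W)
      ⟨⊥, inferInstance, by simp⟩ (fun e heC he hmin => ?_) (fun e f => hsup e f 1) (one_mem C) hone
    refine hC.induction_of_trace_ge hε hbd
      (P := fun f => ∃ W : Submodule ℂ (H →L[ℂ] H), FiniteDimensional ℂ W ∧ ∀ x ∈ M, e * x * f ∈ W)
      ⟨⊥, inferInstance, by simp⟩ (fun f hfC hf hmin' => ?_) (fun f g => hsup' f g e) (one_mem C)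
      hone
    obtain ⟨v, hv⟩ := exists_corner_le_span (hC.le e heC) (hC.le f hfC) he hf
      (hatom e heC he hmin) (hatom f hfC hf hmin')
    exact ⟨_, inferInstance, hv⟩
  have hle : Subalgebra.toSubmodule M.toStarSubalgebra.toSubalgebra ≤ W := fun x hx => by
    simpa using hMW x hx
  have : FiniteDimensional ℂ (Subalgebra.toSubmodule M.toStarSubalgebra.toSubalgebra) :=
    Submodule.finiteDimensional_of_le hle
  exact this

end IsAveragingSubalgebra

/-! ### Stable mean-value ergodicity -/

theorem exists_star_mul_self_eq {M : VonNeumannAlgebra H} {z : H →L[ℂ] H} (hzM : z ∈ M)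
    (hz : 0 ≤ z) : ∃ s ∈ M, z = star s * s := by
  have hs : 0 ≤ CFC.sqrt z := CFC.sqrt_nonneg z
  refine ⟨CFC.sqrt z, mem_of_forall_commute fun w hw => ?_, ?_⟩
  · have hc : Commute z w := mem_commutant_iff.1 hw z hzM
    exact (hc.cfcₙ_nnreal _).symm.eq
  · rw [(IsSelfAdjoint.of_nonneg hs).star_eq, CFC.sqrt_mul_sqrt_self z hz]

theorem IsTraceFunctional.eq_zero_of_nonneg {M : VonNeumannAlgebra H} {Φ : (H →L[ℂ] H) →ₗ[ℂ] ℂ}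
    (hΦ : M.IsTraceFunctional Φ) {z : H →L[ℂ] H} (hzM : z ∈ M) (hz : 0 ≤ z) (h : Φ z = 0) :
    z = 0 := by
  obtain ⟨s, hs, rfl⟩ := exists_star_mul_self_eq hzM hz
  rw [hΦ.faithful s hs h, mul_zero]

/-- Projections of `M` whose traces tend to zero along an ultrafilter converge to zero in the strong
operator topology. -/
theorem IsTraceFunctional.tendsto_apply_zero {M : VonNeumannAlgebra H}
    {Φ : (H →L[ℂ] H) →ₗ[ℂ] ℂ} (hΦ : M.IsTraceFunctional Φ) {ι : Type*} {F : Ultrafilter ι}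
    {f : ι → H →L[ℂ] H} (hfM : ∀ i, f i ∈ M) (hf : ∀ i, IsStarProjection (f i))
    (h : Tendsto (fun i => Φ (f i)) F (𝓝 0)) (ξ : H) : Tendsto (fun i => f i ξ) F (𝓝 0) := by
  have hnorm : ∀ i, ‖f i‖ ≤ 1 := fun i => by
    by_cases h0 : f i = 0
    · rw [h0]; simp
    · exact (norm_eq_one_of_isStarProjection (hf i) h0).le
  obtain ⟨z, hz1, hz⟩ := (isCompact_wot_closedBall (H := H) 1).ultrafilter_le_nhds
    (F.map fun i => ofCLM (f i)) (by
      rw [le_principal_iff]; exact Filter.mem_map.2 (Eventually.of_forall hnorm))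
  have hz' : Tendsto (fun i => (ofCLM (f i) : H →WOT[ℂ] H)) F (𝓝 z) := hz
  have hinner := tendsto_iff_forall_inner_apply_tendsto.1 hz'
  have hzM : z.toCLM ∈ M := M.isWOTClosed_coe.mem_of_tendsto hz' (Eventually.of_forall hfM)
  have hself : ∀ i ξ, (inner ℂ ξ (f i ξ) : ℂ) = ((‖f i ξ‖ ^ 2 : ℝ) : ℂ) := fun i ξ => by
    have h1 : f i ξ = star (f i) (f i ξ) := by
      rw [(hf i).isSelfAdjoint.star_eq]
      exact (congrArg (fun T : H →L[ℂ] H => T ξ) (hf i).isIdempotentElem.eq).symm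
    conv_lhs => rw [h1, ContinuousLinearMap.star_eq_adjoint,
      ContinuousLinearMap.adjoint_inner_right]
    rw [inner_self_eq_norm_sq_to_K]
    norm_cast
  have hz0 : 0 ≤ z.toCLM := by
    rw [ContinuousLinearMap.nonneg_iff_isPositive, ContinuousLinearMap.isPositive_iff_complex]
    intro ξ
    have hlim := hinner ξ ξ
    simp only [ofCLM_apply, hself] at hlim
    have hre : Tendsto (fun i => ‖f i ξ‖ ^ 2) F (𝓝 (inner ℂ ξ (z ξ) : ℂ).re) := by
      have := (Complex.continuous_re.tendsto _).comp hlim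
      exact this.congr fun i => Complex.ofReal_re _
    have him : Tendsto (fun _ : ι => (0 : ℝ)) F (𝓝 (inner ℂ ξ (z ξ) : ℂ).im) := by
      have := (Complex.continuous_im.tendsto _).comp hlim
      exact this.congr fun i => Complex.ofReal_im _
    have h1 : 0 ≤ (inner ℂ ξ (z ξ) : ℂ).re := ge_of_tendsto' hre fun i => by positivity
    have h2 : (inner ℂ ξ (z ξ) : ℂ).im = 0 := tendsto_nhds_unique him tendsto_const_nhds
    have h3 : (inner ℂ (z.toCLM ξ) ξ : ℂ) = inner ℂ ξ (z ξ) := by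
      rw [← inner_conj_symm]; exact Complex.conj_eq_iff_im.2 h2
    rw [h3]
    exact ⟨Complex.ext (by simp) (by simp [h2]), h1⟩
  have hΦz : Φ z.toCLM = 0 := by
    have hw : Tendsto (fun i => (ofCLM (f i) : H →WOT[ℂ] H)) F
        (𝓝[toCLM ⁻¹' {x | ‖x‖ ≤ 1}] z) :=
      tendsto_nhdsWithin_iff.2 ⟨hz', Eventually.of_forall hnorm⟩
    exact tendsto_nhds_unique ((hΦ.continuousOn 1 z hz1).tendsto.comp hw) h
  have hz00 : z.toCLM = 0 := hΦ.eq_zero_of_nonneg hzM hz0 hΦz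
  have hlim := hinner ξ ξ
  have hzξ : z ξ = 0 := congrArg (fun T : H →L[ℂ] H => T ξ) hz00
  simp only [ofCLM_apply, hself, hzξ, inner_zero_right] at hlim
  have hsq : Tendsto (fun i => ‖f i ξ‖ ^ 2) F (𝓝 0) := by
    have := (Complex.continuous_re.tendsto _).comp hlim
    exact this.congr fun i => Complex.ofReal_re _
  rw [tendsto_zero_iff_norm_tendsto_zero]
  have := (Real.continuous_sqrt.tendsto _).comp hsq
  rw [Real.sqrt_zero] at this
  exact this.congr fun i => Real.sqrt_sq (norm_nonneg _)

/-- Mean-value ergodicity at `p` follows if `p` has mean-value ergodic subprojections with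
complement of arbitrarily small trace. -/
theorem isMVErgodicAt_of_forall_trace_sub_le {M N : VonNeumannAlgebra H} (hMN : M ≤ N)
    {Φ : (H →L[ℂ] H) →ₗ[ℂ] ℂ} (hΦ : M.IsTraceFunctional Φ) {p : H →L[ℂ] H} (hpM : p ∈ M)
    (hp : IsStarProjection p)
    (h : ∀ ε > 0, ∃ q ∈ M, IsStarProjection q ∧ p * q = q ∧ M.IsMVErgodicAt N q ∧
      (Φ (p - q)).re ≤ ε) : M.IsMVErgodicAt N p := by
  intro x hx hpx
  choose q hqM hq hpq hgood hΦq using fun n : ℕ => h (1 / ((n : ℝ) + 1)) (by positivity)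
  choose c hcx hc using fun n => (hgood n).exists_add_mem_averages hMN hpM (hqM n) hp (hq n)
    (hpq n) hx hpx
  have hfM : ∀ n, p - q n ∈ M := fun n => sub_mem hpM (hqM n)
  have hf : ∀ n, IsStarProjection (p - q n) := fun n => (isStarProjection_sub hp (hq n) (hpq n)).2
  let F : Ultrafilter ℕ := Filter.hyperfilter ℕ
  have hF : (F : Filter ℕ) ≤ atTop := by
    rw [← Nat.cofinite_eq_atTop]; exact Filter.hyperfilter_le_cofinite
  have htr : Tendsto (fun n => Φ (p - q n)) F (𝓝 0) := by
    have hre : ∀ n, Φ (p - q n) = ((Φ (p - q n)).re : ℂ) := fun n => by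
      have := (hΦ.nonneg _ (hfM n)).2
      rw [(hf n).isSelfAdjoint.star_eq, (hf n).isIdempotentElem.eq] at this
      exact Complex.ext rfl this
    have h0 : Tendsto (fun n => (Φ (p - q n)).re) atTop (𝓝 0) :=
      squeeze_zero (fun n => hΦ.re_nonneg (hfM n) (hf n)) hΦq
        tendsto_one_div_add_atTop_nhds_zero_nat
    have h1 := (Complex.continuous_ofReal.tendsto 0).comp (h0.mono_left hF)
    rw [Complex.ofReal_zero] at h1
    exact h1.congr fun n => (hre n).symm
  have hstrong := hΦ.tendsto_apply_zero (F := F) hfM hf htr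
  obtain ⟨c₀, -, hc₀⟩ := (isCompact_closedBall (0 : ℂ) ‖x‖).ultrafilter_le_nhds (F.map c) (by
    rw [le_principal_iff]
    exact Filter.mem_map.2 (Eventually.of_forall fun n => mem_closedBall_zero_iff.2 (hcx n)))
  have hc₀' : Tendsto c F (𝓝 c₀) := hc₀
  refine ⟨c₀, ?_⟩
  have hlim : Tendsto (fun n => (ofCLM (c n • q n + (p - q n) * x * (p - q n)) : H →WOT[ℂ] H)) F
      (𝓝 (ofCLM (c₀ • p))) := by
    refine tendsto_iff_forall_inner_apply_tendsto.2 fun ξ η => ?_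
    have hqξ : Tendsto (fun n => q n ξ) F (𝓝 (p ξ)) := by
      have := (tendsto_const_nhds (x := p ξ)).sub (hstrong ξ)
      rw [sub_zero] at this
      exact this.congr fun n => by simp
    have hsnd : Tendsto (fun n => (p - q n) (x ((p - q n) ξ))) F (𝓝 0) := by
      have h1 : Tendsto (fun n => x ((p - q n) ξ)) F (𝓝 0) := by
        have := (x.continuous.tendsto 0).comp (hstrong ξ)
        rwa [map_zero] at this
      refine squeeze_zero_norm (fun n => ?_) (tendsto_zero_iff_norm_tendsto_zero.1 h1)
      refine (ContinuousLinearMap.le_opNorm _ _).trans ?_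
      have : ‖p - q n‖ ≤ 1 := by
        by_cases h0 : p - q n = 0
        · rw [h0]; simp
        · exact (norm_eq_one_of_isStarProjection (hf n) h0).le
      exact mul_le_of_le_one_left (norm_nonneg _) this
    have := (hc₀'.smul hqξ).add hsnd
    rw [add_zero] at this
    exact tendsto_const_nhds.inner this
  exact (isWOTClosed_averages (M := M) (p := p) (x := x)).mem_of_tendsto hlim
    (Eventually.of_forall hc)

/-- Given a nonzero mean-value ergodic projection `r`, copies of `r` exhaust any projection `p` up
to a remainder of trace at most that of `r`. -/
theorem exists_isMVErgodicAt_le {M N : VonNeumannAlgebra H} (hM : M.IsFactor) (hMN : M ≤ N)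
    {Φ : (H →L[ℂ] H) →ₗ[ℂ] ℂ} (hΦ : M.IsTraceFunctional Φ) {r : H →L[ℂ] H} (hrM : r ∈ M)
    (hr : IsStarProjection r) (hgood : M.IsMVErgodicAt N r) (n : ℕ) :
    ∀ p ∈ M, IsStarProjection p → (Φ p).re < n * (Φ r).re →
      ∃ q ∈ M, IsStarProjection q ∧ p * q = q ∧ M.IsMVErgodicAt N q ∧
        (Φ (p - q)).re ≤ (Φ r).re := by
  induction n with
  | zero =>
    intro p hpM hp hlt
    have := hΦ.re_nonneg hpM hp
    simp only [Nat.cast_zero, zero_mul] at hlt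
    linarith
  | succ n ih =>
    intro p hpM hp hlt
    push_cast at hlt
    obtain ⟨v, hvM, hpv, hvr, hvvv, hv⟩ := hM.exists_partial_isometry hrM hpM hr hp
    have hsM : star v ∈ M := star_mem hvM
    have htr : Φ (v * star v) = Φ (star v * v) := hΦ.tracial v hvM _ hsM
    rcases hv with hv | hv
    · have he : IsStarProjection (v * star v) :=
        ⟨by rw [IsIdempotentElem, ← mul_assoc, hvvv], by rw [IsSelfAdjoint, star_mul, star_star]⟩
      have heM : v * star v ∈ M := mul_mem hvM hsM
      have hpe : p * (v * star v) = v * star v := by rw [← mul_assoc, hpv]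
      have hegood : M.IsMVErgodicAt N (v * star v) :=
        IsMVErgodicAt.of_partial_isometry hMN hvM hvvv (hv ▸ hgood)
      rw [hv] at htr
      set e := v * star v
      have hsub := isStarProjection_sub hp he hpe
      have htrsub : (Φ (p - e)).re = (Φ p).re - (Φ r).re := by
        rw [map_sub, htr, Complex.sub_re]
      obtain ⟨q, hqM, hq, hpq, hqgood, hqtr⟩ := ih (p - e) (sub_mem hpM heM) hsub.2 (by linarith)
      have heq : e * q = 0 := by
        rw [← hpq, ← mul_assoc, mul_sub, hsub.1, he.isIdempotentElem.eq, sub_self, zero_mul]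
      have hqe : q * e = 0 := by
        have := congrArg star heq
        rwa [star_mul, he.isSelfAdjoint.star_eq, hq.isSelfAdjoint.star_eq, star_zero] at this
      refine ⟨e + q, add_mem heM hqM, ⟨?_, he.isSelfAdjoint.add hq.isSelfAdjoint⟩, ?_,
        IsMVErgodicAt.add hM hMN heM hqM he hq heq hegood hqgood, ?_⟩
      · rw [IsIdempotentElem, mul_add, add_mul, add_mul, heq, hqe, he.isIdempotentElem.eq,
          hq.isIdempotentElem.eq, add_zero, zero_add]
      · rw [sub_mul, heq, sub_zero] at hpq
        rw [mul_add, hpe, hpq]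
      · rw [← sub_sub]; exact hqtr
    · refine ⟨0, zero_mem M, .zero _, by simp, isMVErgodicAt_zero M N, ?_⟩
      rw [sub_zero, ← hv, htr]
      have hsv : IsStarProjection (star v * v) :=
        ⟨by rw [IsIdempotentElem, mul_assoc, ← mul_assoc v, hvvv], by
          rw [IsSelfAdjoint, star_mul, star_star]⟩
      have hrsv : r * (star v * v) = star v * v := by
        have := congrArg star hvr
        rw [star_mul, hr.isSelfAdjoint.star_eq] at this
        rw [← mul_assoc, this]
      have h1 := hΦ.re_nonneg (sub_mem hrM (mul_mem hsM hvM)) (isStarProjection_sub hr hsv hrsv).2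
      rw [map_sub, Complex.sub_re] at h1
      linarith

theorem IsAveragingSubalgebra.isMVErgodic {M N : VonNeumannAlgebra H}
    {C : StarSubalgebra ℂ (H →L[ℂ] H)} (hC : M.IsAveragingSubalgebra N C) : M.IsMVErgodic N :=
  isMVErgodic_of_isMVErgodicAt_one (hC.isMVErgodicAt 1 (one_mem C) (.one _))

/-- In the `II₁` case every projection is filled up to small trace by copies of small projections
of `C`. -/
theorem IsAveragingSubalgebra.isStablyMVErgodic {M N : VonNeumannAlgebra H}
    {C : StarSubalgebra ℂ (H →L[ℂ] H)} (hC : M.IsAveragingSubalgebra N C) (hMN : M ≤ N)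
    (hII : M.IsTypeII1Factor) : M.IsStablyMVErgodic N := by
  intro p hpM hp
  obtain ⟨Φ, hΦ⟩ := hII.exists_isTraceFunctional
  refine IsMVErgodicAt.mvErgodicWithUnit (hMN hpM) hp
    (isMVErgodicAt_of_forall_trace_sub_le hMN hΦ hpM hp fun ε hε => ?_)
  obtain ⟨r, hrC, hr, hr0, hrε⟩ := hC.exists_trace_lt hMN hII.2.1 Φ hε
  have hrM := hC.le r hrC
  obtain ⟨n, hn⟩ := exists_nat_gt ((Φ p).re / (Φ r).re)
  obtain ⟨q, hqM, hq, hpq, hgood, hqtr⟩ := exists_isMVErgodicAt_le hII.1 hMN hΦ hrM hr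
    (hC.isMVErgodicAt r hrC hr) n p hpM hp ((div_lt_iff₀ (hΦ.re_pos hrM hr hr0)).1 hn)
  exact ⟨q, hqM, hq, hpq, hgood, hqtr.trans hrε.le⟩

end VonNeumannAlgebra

theorem proposition2p3 {H : Type*} [NormedAddCommGroup H] [InnerProductSpace ℂ H]
    [CompleteSpace H] (M N : VonNeumannAlgebra H) (hM : M.IsFactor) (hN : N.IsFactor)
    (hMN : M ≤ N) :
    (M.IsRErgodic N ∨ M.IsMASAErgodic N →
      M.IsMVErgodic N ∧ (M.IsTypeII1Factor → M.IsStablyMVErgodic N)) ∧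
    (M.IsMVErgodic N → M.IsErgodic N) := by
  refine ⟨fun h => ?_, fun h => h.isErgodic⟩
  obtain ⟨C, hC⟩ : ∃ C, M.IsAveragingSubalgebra N C := by
    rcases h with ⟨R, hRM, hR, herg⟩ | ⟨A, hA, hAM, hmax⟩
    · exact VonNeumannAlgebra.isAveragingSubalgebra_of_hyperfinite hMN hRM hR herg
    · exact ⟨A, VonNeumannAlgebra.isAveragingSubalgebra_of_masa hM hMN hA hAM hmax⟩
  exact ⟨hC.isMVErgodic, fun hII => hC.isStablyMVErgodic hMN hII⟩
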